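/- Let $(X,\sim)$ be a graph with symmetric relation $\sim$, without loops or multiple edges, whose vertex degrees are uniformly bounded, and let $H$ be its adjacency operator on $\mathcal H=\ell^2(X)$, $(H\varphi)(x)=\sum_{y\sim x}\varphi(y)$. Let $<$ be a relation on $X$ such that $x\sim y$ if and only if $x<y$ or $y<x$, and such that $x<y$ and $y<x$ never hold together. Assume that the directed graph $(X,<)$ is admissible: (i) each closed path has the same number of positively and negatively oriented edges; (ii) for all $x,y\in X$, $\#\{z: x<z,\ y<z\}=\#\{z: z<x,\ z<y\}$. Let $$(K\varphi)(x)=i\Big(\sum_{y>x}\varphi(y)-\sum_{y<x}\varphi(y)\Big),\qquad \varphi\in\mathcal H .$$ Then: 1. $H$ and $K$ are bounded self-adjoint operators with $[K,H]=0$. There is a position function, that is, $\Phi:X\to\mathbb Z$ with $\Phi(y)=\Phi(x)+1$ whenever $x<y$. 2. For every position function $\Phi$, the operator $\frac12(\Phi K+K\Phi)$ on the finitely supported functions is essentially self-adjoint. Let $A$ be its closure. Then $H\in C^1(A)$ with $[iH,A]=K^2$, and $K^2\in C^1(A)$. Here $S\in C^1(A)$ means that $t\mapsto e^{-itA}Se^{itA}$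 is strongly of class $C^1$, equivalently, that the quadratic form $\varphi\mapsto\langle\varphi,iSA\varphi\rangle-\langle A\varphi,iS\varphi\rangle$ on $\mathrm{dom}(A)$ is the form of a bounded operator, denoted $[iS,A]$. 3. For every such $A$, the strong limit $$D=\operatorname*{s-lim}_{t\to\infty}\frac1t\int_0^t ds\,e^{isH}(H+i)^{-1}[iH,A](H-i)^{-1}e^{-isH}$$ exists and equals $K^2(H^2+1)^{-1}$, and $D^{-1}\eta(D)\,\mathrm{dom}(A)\subset\mathrm{dom}(A)$ for each $\eta\in C^\infty_{\rm c}(\mathbb R\setminus\{0\})$. 4. $\ker(D)=\ker(K)$, the subspace $\ker(K)^\perp$ is invariant under $H$, and the self-adjoint operator $H|_{\ker(K)^\perp}$ has purely absolutely continuous spectrum. -/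

import Mathlib

open Filter Topology MeasureTheory
open scoped InnerProductSpace

noncomputable section

/-! ## Commutators with an unbounded self-adjoint operator -/

section Abstract

variable {E : Type*} [NormedAddCommGroup E] [InnerProductSpace ℂ E] [CompleteSpace E]

/-- `W t = e^{itA}`: the family `W` is a strongly continuous one-parameter unitary group and its
infinitesimal generator is `A`, with exactly the domain of `A`. -/
structure IsUnitaryGroupOf (A : E →ₗ.[ℂ] E) (W : ℝ → E →L[ℂ] E) : Prop where
  map_zero : W 0 = 1
  map_add : ∀ s t : ℝ, W (s + t) = W s * W t
  unitary : ∀ t : ℝ, W t ∈ unitary (E →L[ℂ] E)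
  continuous : ∀ φ : E, Continuous fun t : ℝ => W t φ
  generator : ∀ φ ψ : E,
    (φ, ψ) ∈ A.graph ↔ HasDerivAt (fun t : ℝ => W t φ) (Complex.I • ψ) 0

/-- `C = [iS, A]`: the quadratic form `φ ↦ ⟨φ, iSAφ⟩ - ⟨Aφ, iSφ⟩` on the domain of `A` is the form of
the bounded operator `C`. (The inner product is antilinear in the first argument.) -/
def IsCommutator (A : E →ₗ.[ℂ] E) (S C : E →L[ℂ] E) : Prop :=
  ∀ φ : A.domain,
    ⟪(φ : E), Complex.I • S (A φ)⟫_ℂ - ⟪A φ, Complex.I • S (φ : E)⟫_ℂ = ⟪(φ : E), C φ⟫_ℂ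

/-- `S ∈ C¹(A)`: the map `t ↦ e^{-itA} S e^{itA}` is strongly of class `C¹` and (equivalently, when
`A` is self-adjoint) the quadratic form `[iS, A]` extends to that of a bounded operator. By Stone's
theorem there is exactly one group `W` to consider when `A` is self-adjoint. -/
def MemC1 (A : E →ₗ.[ℂ] E) (S : E →L[ℂ] E) : Prop :=
  (∃ C : E →L[ℂ] E, IsCommutator A S C) ∧
    ∀ W : ℝ → E →L[ℂ] E, IsUnitaryGroupOf A W →
      ∀ φ : E, ContDiff ℝ 1 fun t : ℝ => W (-t) (S (W t φ))

/-- `e^{isH}` for a bounded operator `H`. -/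
def expI (H : E →L[ℂ] E) (s : ℝ) : E →L[ℂ] E := NormedSpace.exp ((Complex.I * (s : ℂ)) • H)

/-- For a bounded self-adjoint `H`: the operator `D` is the strong limit, as `t → ∞`, of
`(1/t) ∫₀ᵗ e^{isH} (H + i)⁻¹ [iH, A] (H - i)⁻¹ e^{-isH} ds`. -/
def IsDegree (H : E →L[ℂ] E) (A : E →ₗ.[ℂ] E) (D : E →L[ℂ] E) : Prop :=
  ∃ C : E →L[ℂ] E, IsCommutator A H C ∧
    ∀ φ : E, Tendsto
      (fun t : ℝ => (1 / t) • ∫ s in (0 : ℝ)..t,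
        (expI H s * Ring.inverse (H + Complex.I • (1 : E →L[ℂ] E)) * C *
          Ring.inverse (H - Complex.I • (1 : E →L[ℂ] E)) * expI H (-s)) φ)
      atTop (𝓝 (D φ))

/-- `f(T)` for a bounded self-adjoint operator `T` and a function `f` on the real line. -/
def realCalculus (f : ℝ → ℂ) (T : E →L[ℂ] E) : E →L[ℂ] E := cfc (fun z : ℂ => f z.re) T

/-- `μ` is the spectral measure of the bounded self-adjoint operator `T` at the vector `φ`. -/
def IsSpectralMeasure (T : E →L[ℂ] E) (φ : E) (μ : Measure ℝ) : Prop :=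
  IsFiniteMeasure μ ∧
    ∀ f : ℝ → ℂ, Continuous f → HasCompactSupport f →
      ∫ x, f x ∂μ = ⟪φ, realCalculus f T φ⟫_ℂ

/-- The operator `T` is bounded self-adjoint and has purely absolutely continuous spectrum: all its
spectral measures are absolutely continuous with respect to Lebesgue measure. -/
def IsPurelyAbsolutelyContinuous (T : E →L[ℂ] E) : Prop :=
  IsSelfAdjoint T ∧ ∀ φ : E, ∃ μ : Measure ℝ, IsSpectralMeasure T φ μ ∧ μ ≪ volume

end Abstract

/-! ## Operators on `ℓ²(X)` attached to a relation of uniformly bounded degree -/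

section Graphs

variable {X : Type*}

/-- The Hilbert space `ℓ²(X)`. -/
abbrev EllTwo (X : Type*) := lp (fun _ : X => ℂ) 2

/-- Every point has at most `d` successors and at most `d` predecessors, with `d` uniform. -/
def BoundedRel (r : X → X → Prop) : Prop :=
  ∃ d : ℕ, ∀ x : X, {y | r x y}.encard ≤ d ∧ {y | r y x}.encard ≤ d

theorem BoundedRel.finite {r : X → X → Prop} (h : BoundedRel r) (x : X) : {y | r x y}.Finite := by
  obtain ⟨d, hd⟩ := h
  exact Set.finite_of_encard_le_coe (hd x).1

theorem BoundedRel.finite' {r : X → X → Prop} (h : BoundedRel r) (x : X) : {y | r y x}.Finite := by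
  obtain ⟨d, hd⟩ := h
  exact Set.finite_of_encard_le_coe (hd x).2

/-- The sum of `φ` over the `r`-successors of `x`. -/
def relSum (r : X → X → Prop) (φ : X → ℂ) (x : X) : ℂ := ∑ᶠ y ∈ {y | r x y}, φ y

theorem relSum_eq {r : X → X → Prop} (h : BoundedRel r) (φ : X → ℂ) (x : X) :
    relSum r φ x = ∑ y ∈ (h.finite x).toFinset, φ y :=
  finsum_mem_eq_finite_toFinset_sum _ _

theorem relSum_bound {r : X → X → Prop} (h : BoundedRel r) :
    ∃ d : ℕ, ∀ (φ : EllTwo X) (s : Finset X),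
      ∑ x ∈ s, ‖relSum r φ x‖ ^ (2 : ENNReal).toReal ≤ (d * ‖φ‖) ^ (2 : ENNReal).toReal := by
  classical
  obtain ⟨d, hd⟩ := id h
  refine ⟨d, fun φ s => ?_⟩
  have hl := lp.sum_rpow_le_norm_rpow (p := 2) (by norm_num) φ
    (s.biUnion fun x => (h.finite x).toFinset)
  simp only [ENNReal.toReal_ofNat, Real.rpow_ofNat] at hl ⊢
  have hc1 : ∀ x, ((h.finite x).toFinset.card : ℝ) ≤ d := by
    intro x
    have := (hd x).1
    rw [(h.finite x).encard_eq_coe_toFinset_card] at this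
    exact_mod_cast this
  have hc2 : ∀ y, ((s.filter fun x => r x y).card : ℝ) ≤ d := by
    intro y
    have h2 := (hd y).2
    rw [(h.finite' y).encard_eq_coe_toFinset_card] at h2
    have h3 : (s.filter fun x => r x y).card ≤ (h.finite' y).toFinset.card :=
      Finset.card_le_card fun x hx => by simpa using (Finset.mem_filter.1 hx).2
    have h4 : (h.finite' y).toFinset.card ≤ d := by exact_mod_cast h2
    exact_mod_cast h3.trans h4
  calc ∑ x ∈ s, ‖relSum r φ x‖ ^ 2
      ≤ ∑ x ∈ s, d * ∑ y ∈ (h.finite x).toFinset, ‖φ y‖ ^ 2 := by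
        refine Finset.sum_le_sum fun x _ => ?_
        rw [relSum_eq h]
        have h1 : ‖∑ y ∈ (h.finite x).toFinset, φ y‖ ^ 2 ≤
            (∑ y ∈ (h.finite x).toFinset, ‖φ y‖) ^ 2 :=
          pow_le_pow_left₀ (norm_nonneg _) (norm_sum_le _ _) 2
        refine h1.trans (sq_sum_le_card_mul_sum_sq.trans ?_)
        exact mul_le_mul_of_nonneg_right (hc1 x) (Finset.sum_nonneg fun _ _ => sq_nonneg _)
    _ = d * ∑ y ∈ s.biUnion fun x => (h.finite x).toFinset,
          ((s.filter fun x => r x y).card : ℝ) * ‖φ y‖ ^ 2 := by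
        rw [← Finset.mul_sum]
        congr 1
        rw [Finset.sum_comm' (t' := s.biUnion fun x => (h.finite x).toFinset)
          (s' := fun y => s.filter fun x => r x y)]
        · simp
        · intro x y
          simp only [Set.Finite.mem_toFinset, Set.mem_ofPred_eq, Finset.mem_filter,
            Finset.mem_biUnion]
          tauto
    _ ≤ d * ∑ y ∈ s.biUnion fun x => (h.finite x).toFinset, (d : ℝ) * ‖φ y‖ ^ 2 := by
        refine mul_le_mul_of_nonneg_left (Finset.sum_le_sum fun y _ => ?_) (Nat.cast_nonneg d)
        exact mul_le_mul_of_nonneg_right (hc2 y) (sq_nonneg _)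
    _ = (d : ℝ) ^ 2 * ∑ y ∈ s.biUnion fun x => (h.finite x).toFinset, ‖φ y‖ ^ 2 := by
        rw [← Finset.mul_sum]; ring
    _ ≤ (d : ℝ) ^ 2 * ‖φ‖ ^ 2 := by gcongr
    _ = (d * ‖φ‖) ^ 2 := by ring

theorem relSum_memℓp {r : X → X → Prop} (h : BoundedRel r) (φ : EllTwo X) :
    Memℓp (E := fun _ : X => ℂ) (relSum r φ) 2 := by
  obtain ⟨d, hd⟩ := relSum_bound h
  exact memℓp_gen' (hd φ)

/-- The bounded operator `(Tφ)(x) = ∑_{y : r x y} φ(y)` on `ℓ²(X)`. -/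
def relOp {r : X → X → Prop} (h : BoundedRel r) : EllTwo X →L[ℂ] EllTwo X :=
  LinearMap.mkContinuousOfExistsBound
    { toFun := fun φ => ⟨relSum r φ, relSum_memℓp h φ⟩
      map_add' := fun φ ψ => by
        apply Subtype.ext
        funext x
        change relSum r (⇑(φ + ψ)) x = relSum r φ x + relSum r ψ x
        simp only [relSum_eq h, lp.coeFn_add, Pi.add_apply, Finset.sum_add_distrib]
      map_smul' := fun c φ => by
        apply Subtype.ext
        funext x
        change relSum r (⇑(c • φ)) x = c • relSum r φ x
        simp only [relSum_eq h, lp.coeFn_smul, Pi.smul_apply, Finset.smul_sum] }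
    (by
      obtain ⟨d, hd⟩ := relSum_bound h
      exact ⟨d, fun φ => lp.norm_le_of_forall_sum_le (by norm_num) (by positivity) (hd φ)⟩)

theorem relOp_apply {r : X → X → Prop} (h : BoundedRel r) (φ : EllTwo X) (x : X) :
    relOp h φ x = ∑ᶠ y ∈ {y | r x y}, φ y := rfl

/-! ## Graphs, directed graphs, admissibility -/

/-- The graph has finite degree: the number of neighbours of a vertex is uniformly bounded. -/
def HasFiniteDegree (G : SimpleGraph X) : Prop :=
  ∃ d : ℕ, ∀ x : X, (G.neighborSet x).encard ≤ d

/-- The relation `r x y`, read `x < y`, makes `X` a directed graph subjacent to `G`. -/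
def IsSubjacent (G : SimpleGraph X) (r : X → X → Prop) : Prop :=
  (∀ x y : X, G.Adj x y ↔ r x y ∨ r y x) ∧ ∀ x y : X, ¬(r x y ∧ r y x)

open Classical in
/-- The number of steps `a → b` with `a < b` of a path. -/
def ascents {G : SimpleGraph X} (r : X → X → Prop) {x y : X} (p : G.Walk x y) : ℕ :=
  p.darts.countP fun e => decide (r e.fst e.snd)

open Classical in
/-- The number of steps `a → b` with `b < a` of a path. -/
def descents {G : SimpleGraph X} (r : X → X → Prop) {x y : X} (p : G.Walk x y) : ℕ :=
  p.darts.countP fun e => decide (r e.snd e.fst)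

/-- Admissible directed graph: closed paths have as many positively as negatively oriented edges,
and any two vertices have as many common successors as common predecessors. -/
structure IsAdmissible (G : SimpleGraph X) (r : X → X → Prop) : Prop where
  closed_path : ∀ (x : X) (p : G.Walk x x), ascents r p = descents r p
  common : ∀ x y : X, ({z | r x z} ∩ {z | r y z}).encard = ({z | r z x} ∩ {z | r z y}).encard

theorem HasFiniteDegree.boundedRel {G : SimpleGraph X} (hG : HasFiniteDegree G) :
    BoundedRel G.Adj := by
  obtain ⟨d, hd⟩ := hG
  exact ⟨d, fun x => ⟨hd x, (Set.encard_le_encard fun y hy => G.adj_symm hy).trans (hd x)⟩⟩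

theorem HasFiniteDegree.boundedRel_subjacent {G : SimpleGraph X} (hG : HasFiniteDegree G)
    {r : X → X → Prop} (hr : IsSubjacent G r) : BoundedRel r := by
  obtain ⟨d, hd⟩ := hG
  exact ⟨d, fun x =>
    ⟨(Set.encard_le_encard fun y hy => (hr.1 x y).2 (Or.inl hy)).trans (hd x),
     (Set.encard_le_encard fun y hy => (hr.1 x y).2 (Or.inr hy)).trans (hd x)⟩⟩

theorem BoundedRel.swap {r : X → X → Prop} (h : BoundedRel r) :
    BoundedRel fun x y => r y x := by
  obtain ⟨d, hd⟩ := h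
  exact ⟨d, fun x => ⟨(hd x).2, (hd x).1⟩⟩

/-- The adjacency operator `(Hφ)(x) = ∑_{y ∼ x} φ(y)`. -/
def adjacencyOp (G : SimpleGraph X) (hG : HasFiniteDegree G) : EllTwo X →L[ℂ] EllTwo X :=
  relOp hG.boundedRel

/-- The operator `(Kφ)(x) = i (∑_{y : x < y} φ(y) - ∑_{y : y < x} φ(y))`. -/
def conjugateK {r : X → X → Prop} (h : BoundedRel r) : EllTwo X →L[ℂ] EllTwo X :=
  Complex.I • (relOp h - relOp h.swap)

/-- A position function: it increases by one along each edge. -/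
def IsPositionFunction (r : X → X → Prop) (Φ : X → ℤ) : Prop :=
  ∀ x y : X, r x y → Φ y = Φ x + 1

/-- The finitely supported elements of `ℓ²(X)`. -/
def finSupp (X : Type*) : Submodule ℂ (EllTwo X) where
  carrier := {φ | (Function.support φ).Finite}
  zero_mem' := by
    have : (Function.support (0 : X → ℂ)).Finite := by simp
    exact this
  add_mem' := fun {a b} ha hb => by
    simp only [Set.mem_ofPred_eq, lp.coeFn_add] at *
    exact (ha.union hb).subset (Function.support_add _ _)
  smul_mem' := fun c a ha => by
    simp only [Set.mem_ofPred_eq, lp.coeFn_smul] at *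
    exact ha.subset (Function.support_const_smul_subset c _)

theorem relOp_mem_finSupp {r : X → X → Prop} (h : BoundedRel r) {φ : EllTwo X}
    (hφ : φ ∈ finSupp X) : relOp h φ ∈ finSupp X := by
  have hfin : (⋃ y ∈ Function.support φ, {x | r x y}).Finite :=
    Set.Finite.biUnion hφ fun y _ => h.finite' y
  refine hfin.subset fun x hx => ?_
  by_contra hne
  apply hx
  rw [relOp_apply]
  refine finsum_mem_eq_zero_of_forall_eq_zero fun y hy => ?_
  by_contra hy0
  exact hne (Set.mem_biUnion (x := y) hy0 hy)

theorem conjugateK_mem_finSupp {r : X → X → Prop} (h : BoundedRel r) {φ : EllTwo X}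
    (hφ : φ ∈ finSupp X) : conjugateK h φ ∈ finSupp X :=
  (finSupp X).smul_mem _
    ((finSupp X).sub_mem (relOp_mem_finSupp h hφ) (relOp_mem_finSupp h.swap hφ))

/-- `K` on the finitely supported functions. -/
def finK {r : X → X → Prop} (h : BoundedRel r) : finSupp X →ₗ[ℂ] finSupp X :=
  (conjugateK h).toLinearMap.restrict fun _ hφ => conjugateK_mem_finSupp h hφ

/-- Multiplication by `Φ` on the finitely supported functions. -/
def finMul (Φ : X → ℤ) : finSupp X →ₗ[ℂ] finSupp X where
  toFun φ :=
    have hs : (Function.support fun x => (Φ x : ℂ) * (φ : EllTwo X) x).Finite :=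
      Set.Finite.subset φ.2 (Function.support_mul_subset_right _ _)
    ⟨⟨fun x => (Φ x : ℂ) * (φ : EllTwo X) x, (memℓp_zero hs).of_exponent_ge zero_le⟩, hs⟩
  map_add' φ ψ := by
    apply Subtype.ext
    apply Subtype.ext
    funext x
    exact mul_add _ _ _
  map_smul' c φ := by
    apply Subtype.ext
    apply Subtype.ext
    funext x
    exact mul_left_comm _ _ _

/-- The operator `½ (ΦK + KΦ)`, with domain the finitely supported functions. -/
def preConjugateA {r : X → X → Prop} (h : BoundedRel r) (Φ : X → ℤ) :
    EllTwo X →ₗ.[ℂ] EllTwo X where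
  domain := finSupp X
  toFun := (finSupp X).subtype ∘ₗ
    ((1 / 2 : ℂ) • (finMul Φ ∘ₗ finK h + finK h ∘ₗ finMul Φ))

/-- The operator `A`: the closure of `½ (ΦK + KΦ)` on the finitely supported functions. -/
def conjugateA {r : X → X → Prop} (h : BoundedRel r) (Φ : X → ℤ) :
    EllTwo X →ₗ.[ℂ] EllTwo X :=
  (preConjugateA h Φ).closure

end Graphs

end

noncomputable section

/-! ## The shift operator of a directed graph -/

section Operators

variable {X : Type*} {r : X → X → Prop}

/-! Everything is expressed through the shift `U = relOp h`, which sums over successors. Its matrix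
has entries 0 and 1, so `U*` sums over predecessors, `H = U + U*` and `K = i(U - U*)`. The entries
of `U*U` and `UU*` count common predecessors and common successors, so condition (ii) says exactly
that `U` is normal; in particular `H` and `K` commute. Condition (i) makes the signed length of a
walk depend only on its endpoints, which yields a position function `Φ`.

Since `Φ` rises by one along each edge, `UΦ = (Φ + 1)U`. Hence `½(ΦK + KΦ) = i((Φ + ½)U - (Φ -
½)U*)`, an expression that makes sense pointwise on all of `ℓ²` (`formalA`). The adjoint acts by
this formula, and every `φ` on which the formula gives an `ℓ²` function is approximated in graph
norm by cutoffs in `Φ`, then by finite cutoffs (`closure_graph_of_formalA`). This is essential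
self-adjointness. On the core, normality cancels the unbounded terms of the commutators: `[A, H] =
iK²` and `[A, K] = -iHK`. A bounded commutator that preserves the domain gives `C¹` regularity
(`HasCommutator.memC1`). As `K²` commutes with `H`, the averages defining `D` are constant for `t >
0`. Functions of `D` are limits of polynomials in `D` whose commutators with `A` also converge, so
they preserve the domain.

Absolute continuity uses rotation symmetry, with no commutator estimate: the gauge rotations `V θ =
e^{iθΦ}` satisfy `V* U V = e^{iθ} U`, so they rotate the spectral measures of the normal operator
`U`. For a Lebesgue-null set `B` and a fixed `z`, the angles at which `e^{iθ} z` is non-real with `2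
Re (e^{iθ} z) ∈ B` form a null set. By Fubini the spectral measure at `V θ φ` ignores such points
for almost every `θ`, and letting `θ → 0` so does the one at `φ`
(`IsNormalSpectralMeasure.null_re_preimage`). The real axis carries no mass for `φ` in `ker(K)^⊥`,
the closure of the range of `K`. -/

open Classical in
theorem single_mem_finSupp (x : X) (a : ℂ) :
    (lp.single 2 x a : EllTwo X) ∈ finSupp X := by
  refine (Set.finite_singleton x).subset fun y hy => ?_
  by_contra hne
  exact hy (lp.single_apply_ne _ _ _ hne)

theorem dense_finSupp : Dense (finSupp X : Set (EllTwo X)) := by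
  classical
  intro f
  refine mem_closure_of_tendsto (lp.hasSum_single (by norm_num) f) (Eventually.of_forall fun s => ?_)
  exact Submodule.sum_mem _ fun i _ => single_mem_finSupp i _

open Classical in
theorem relOp_single (h : BoundedRel r) (x y : X) :
    relOp h (lp.single 2 y 1) x = if r x y then 1 else 0 := by
  rw [relOp_apply, ← relSum, relSum_eq h]
  simp [lp.single_apply, Pi.single_apply]

open Classical in
theorem EllTwo.clm_ext {S T : EllTwo X →L[ℂ] EllTwo X}
    (h : ∀ x y : X, ⟪(lp.single 2 x 1 : EllTwo X), S (lp.single 2 y 1)⟫_ℂ =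
      ⟪(lp.single 2 x 1 : EllTwo X), T (lp.single 2 y 1)⟫_ℂ) : S = T := by
  have h1 : ∀ y, S (lp.single 2 y 1) = T (lp.single 2 y 1) := by
    intro y
    ext x
    simpa [lp.inner_single_left] using h x y
  ext1 φ
  have hφ := lp.hasSum_single (p := 2) (by norm_num) φ
  refine (S.hasSum hφ).unique ?_
  convert T.hasSum hφ using 2 with y
  have : (lp.single 2 y (φ y) : EllTwo X) = φ y • lp.single 2 y 1 := by
    rw [← lp.single_smul]; simp
  rw [this, map_smul, map_smul, h1]

/-- The matrix is real, so taking the adjoint transposes it, that is, reverses the relation. -/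
theorem adjoint_relOp (h : BoundedRel r) : star (relOp h) = relOp h.swap := by
  classical
  refine EllTwo.clm_ext fun x y => ?_
  rw [ContinuousLinearMap.star_eq_adjoint, ContinuousLinearMap.adjoint_inner_right,
    lp.inner_single_left, lp.inner_single_right, relOp_single, relOp_single]
  split_ifs <;> simp

open Classical in
theorem tsum_ite_mem_eq_ncard {S : Set X} (hS : S.Finite) :
    ∑' z, (if z ∈ S then (1 : ℂ) else 0) = S.ncard := by
  rw [tsum_eq_sum (s := hS.toFinset) (by simp), Set.ncard_eq_toFinset_card S hS]
  rw [Finset.sum_congr rfl (g := fun _ => (1 : ℂ)) (by intro z hz; simpa using hz)]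
  simp

-- The image of the point mass at `x` is the indicator function of the predecessors of `x`.
open Classical in
theorem inner_relOp_single (h : BoundedRel r) (x y : X) :
    ⟪relOp h (lp.single 2 x 1), relOp h (lp.single 2 y 1)⟫_ℂ =
      (({z | r z x} ∩ {z | r z y}).ncard : ℂ) := by
  rw [lp.inner_eq_tsum, ← tsum_ite_mem_eq_ncard ((h.finite' x).inter_of_left _)]
  refine tsum_congr fun z => ?_
  rw [relOp_single, relOp_single]
  by_cases h1 : r z x <;> by_cases h2 : r z y <;> simp [h1, h2]

/-- This is where condition (ii) enters: the matrices of `U*U` and `UU*` count common predecessors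
and common successors. -/
theorem IsAdmissible.isStarNormal_relOp {G : SimpleGraph X} (hadm : IsAdmissible G r)
    (h : BoundedRel r) : IsStarNormal (relOp h) := by
  classical
  refine ⟨EllTwo.clm_ext fun x y => ?_⟩
  have e1 : relOp h = star (relOp h.swap) := by rw [adjoint_relOp]
  calc ⟪(lp.single 2 x 1 : EllTwo X), (star (relOp h) * relOp h) (lp.single 2 y 1)⟫_ℂ
      = ⟪relOp h (lp.single 2 x 1), relOp h (lp.single 2 y 1)⟫_ℂ := by
        rw [mul_apply_eq_comp, ContinuousLinearMap.star_eq_adjoint,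
          ContinuousLinearMap.adjoint_inner_right]
    _ = ⟪relOp h.swap (lp.single 2 x 1), relOp h.swap (lp.single 2 y 1)⟫_ℂ := by
        rw [inner_relOp_single, inner_relOp_single, Set.ncard, Set.ncard, hadm.common]
    _ = ⟪(lp.single 2 x 1 : EllTwo X), (relOp h * star (relOp h)) (lp.single 2 y 1)⟫_ℂ := by
        rw [adjoint_relOp, mul_apply_eq_comp]
        rw [e1, ContinuousLinearMap.star_eq_adjoint, ContinuousLinearMap.adjoint_inner_right]

theorem adjacencyOp_eq {G : SimpleGraph X} (hG : HasFiniteDegree G) (hr : IsSubjacent G r) :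
    adjacencyOp G hG = relOp (hG.boundedRel_subjacent hr) +
      star (relOp (hG.boundedRel_subjacent hr)) := by
  classical
  rw [adjoint_relOp]
  refine EllTwo.clm_ext fun x y => ?_
  rw [add_apply, inner_add_right]
  simp only [adjacencyOp, lp.inner_single_left, relOp_single]
  have h1 := hr.1 x y
  have h2 := hr.2 x y
  by_cases h3 : r x y <;> by_cases h4 : r y x <;> simp_all

theorem conjugateK_eq (h : BoundedRel r) :
    conjugateK h = Complex.I • (relOp h - star (relOp h)) := by
  rw [adjoint_relOp, conjugateK]

/-- Two walks with the same endpoints form a closed path once one is reversed, so they have equal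
ascents minus descents. Measuring this number from a chosen vertex of each connected component gives
`Φ`. -/
theorem IsAdmissible.exists_isPositionFunction {G : SimpleGraph X} (hr : IsSubjacent G r)
    (hadm : IsAdmissible G r) : ∃ Φ : X → ℤ, IsPositionFunction r Φ := by
  classical
  have hrev : ∀ {x y : X} (p : G.Walk x y), ascents r p.reverse = descents r p ∧
      descents r p.reverse = ascents r p := by
    intro x y p
    simp [ascents, descents, SimpleGraph.Walk.darts_reverse, List.countP_map, Function.comp_def]
  have happ : ∀ {x y z : X} (p : G.Walk x y) (q : G.Walk y z),
      ascents r (p.append q) = ascents r p + ascents r q ∧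
      descents r (p.append q) = descents r p + descents r q := by
    intro x y z p q
    simp [ascents, descents, SimpleGraph.Walk.darts_append]
  have hindep : ∀ {x y : X} (p q : G.Walk x y),
      (ascents r p : ℤ) - descents r p = ascents r q - descents r q := by
    intro x y p q
    have h1 := hadm.closed_path x (p.append q.reverse)
    rw [(happ _ _).1, (happ _ _).2, (hrev q).1, (hrev q).2] at h1
    omega
  have hbase : ∀ x : X, G.Reachable (G.connectedComponentMk x).out x := fun x =>
    SimpleGraph.ConnectedComponent.exact (Quot.out_eq _)
  let p : ∀ x : X, G.Walk (G.connectedComponentMk x).out x := fun x => (hbase x).some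
  refine ⟨fun x => ascents r (p x) - descents r (p x), fun x y hxy => ?_⟩
  have hadj : G.Adj x y := (hr.1 x y).2 (Or.inl hxy)
  have hcc : G.connectedComponentMk x = G.connectedComponentMk y :=
    SimpleGraph.ConnectedComponent.sound hadj.reachable
  -- The chosen walk to `y` is compared with the chosen walk to `x` prolonged by the edge; `copy`
  -- only identifies the two base points.
  have h2 := hindep (p y)
    (((p x).copy (by rw [hcc]) rfl).append (SimpleGraph.Walk.cons hadj SimpleGraph.Walk.nil))
  rw [(happ _ _).1, (happ _ _).2] at h2
  have h3 : ¬ r y x := fun h => hr.2 x y ⟨hxy, h⟩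
  have h4 : ascents r ((p x).copy (by rw [hcc] : _ = (G.connectedComponentMk y).out) rfl) =
      ascents r (p x) := by simp [ascents]
  have h5 : descents r ((p x).copy (by rw [hcc] : _ = (G.connectedComponentMk y).out) rfl) =
      descents r (p x) := by simp [descents]
  rw [h4, h5] at h2
  simp [ascents, descents, hxy, h3] at h2 ⊢
  omega

end Operators

/-! ## Essential self-adjointness -/

section EssentialSelfAdjointness

variable {X : Type*} {r : X → X → Prop}

theorem memℓp_of_norm_le {f : X → ℂ} (g : EllTwo X) (h : ∀ x, ‖f x‖ ≤ ‖g x‖) :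
    Memℓp (E := fun _ : X => ℂ) f 2 := by
  have hg := (lp.memℓp g).summable (by norm_num)
  refine memℓp_gen (hg.of_nonneg_of_le (fun x => by positivity) fun x => ?_)
  exact Real.rpow_le_rpow (norm_nonneg _) (h x) (by norm_num)

/-- Dominated convergence in `ℓ²(X)`. -/
theorem EllTwo.tendsto_of_dominated {ι : Type*} {l : Filter ι} {f : ι → EllTwo X} {f₀ : EllTwo X}
    (g : EllTwo X) (hf : ∀ x, Tendsto (fun i => f i x) l (𝓝 (f₀ x)))
    (hg : ∀ i x, ‖f i x - f₀ x‖ ≤ ‖g x‖) : Tendsto f l (𝓝 f₀) := by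
  have hs : Summable fun x => ‖g x‖ ^ 2 := by
    simpa using (lp.memℓp g).summable (by norm_num)
  have h1 : Tendsto (fun i => ∑' x, ‖f i x - f₀ x‖ ^ 2) l (𝓝 (∑' _ : X, (0 : ℝ))) := by
    refine tendsto_tsum_of_dominated_convergence hs (fun x => ?_) (Eventually.of_forall fun i x => ?_)
    · have := ((hf x).sub_const (f₀ x)).norm.pow 2
      simpa using this
    · rw [Real.norm_of_nonneg (by positivity)]
      exact pow_le_pow_left₀ (norm_nonneg _) (hg i x) 2
  rw [tsum_zero] at h1
  rw [tendsto_iff_norm_sub_tendsto_zero]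
  have h2 : ∀ i, ‖f i - f₀‖ = √(∑' x, ‖f i x - f₀ x‖ ^ 2) := by
    intro i
    have := lp.norm_rpow_eq_tsum (p := 2) (by norm_num) (f i - f₀)
    simp only [ENNReal.toReal_ofNat, Real.rpow_ofNat] at this
    rw [← Real.sqrt_sq (norm_nonneg (f i - f₀)), this]
    rfl
  simp_rw [h2]
  simpa using h1.sqrt

/-- The function `|φ|`. -/
def EllTwo.abs (φ : EllTwo X) : EllTwo X :=
  ⟨fun x => (‖φ x‖ : ℂ), memℓp_of_norm_le φ fun x => by simp⟩

theorem EllTwo.abs_apply (φ : EllTwo X) (x : X) : EllTwo.abs φ x = (‖φ x‖ : ℂ) := rfl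

/-- Multiplication by a function bounded by one. -/
def EllTwo.mulOp (m : X → ℂ) (hm : ∀ x, ‖m x‖ ≤ 1) : EllTwo X →L[ℂ] EllTwo X :=
  LinearMap.mkContinuous
    { toFun := fun φ => ⟨fun x => m x * φ x, memℓp_of_norm_le φ fun x => by
        rw [norm_mul]; exact mul_le_of_le_one_left (norm_nonneg _) (hm x)⟩
      map_add' := fun φ ψ => by
        ext x
        exact mul_add _ _ _
      map_smul' := fun c φ => by
        ext x
        exact mul_left_comm _ _ _ } 1 (by
    intro φ
    rw [one_mul]
    refine lp.norm_le_of_forall_sum_le (by norm_num) (norm_nonneg _) fun s => ?_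
    refine le_trans (Finset.sum_le_sum fun x _ => ?_) (lp.sum_rpow_le_norm_rpow (by norm_num) φ s)
    refine Real.rpow_le_rpow (norm_nonneg _) ?_ (by norm_num)
    change ‖m x * φ x‖ ≤ _
    rw [norm_mul]
    exact mul_le_of_le_one_left (norm_nonneg _) (hm x))

theorem EllTwo.mulOp_apply (m : X → ℂ) (hm : ∀ x, ‖m x‖ ≤ 1) (φ : EllTwo X) (x : X) :
    EllTwo.mulOp m hm φ x = m x * φ x := rfl

theorem relOp_apply_eq_sum (h : BoundedRel r) (φ : EllTwo X) (x : X) :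
    relOp h φ x = ∑ y ∈ (h.finite x).toFinset, φ y := by
  rw [relOp_apply, ← relSum, relSum_eq h]

theorem norm_relOp_abs (h : BoundedRel r) (φ : EllTwo X) (x : X) :
    relOp h (EllTwo.abs φ) x = ((∑ y ∈ (h.finite x).toFinset, ‖φ y‖ : ℝ) : ℂ) := by
  rw [relOp_apply_eq_sum]
  push_cast
  rfl

theorem relOp_mulOp_sub (h : BoundedRel r) (m : X → ℂ) (hm : ∀ x, ‖m x‖ ≤ 1) (φ : EllTwo X) (x : X) :
    relOp h (EllTwo.mulOp m hm φ) x - m x * relOp h φ x =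
      ∑ y ∈ (h.finite x).toFinset, (m y - m x) * φ y := by
  rw [relOp_apply_eq_sum, relOp_apply_eq_sum, Finset.mul_sum, ← Finset.sum_sub_distrib]
  exact Finset.sum_congr rfl fun y _ => by rw [EllTwo.mulOp_apply, sub_mul]

/-- The operator `½ (ΦK + KΦ)` acting on arbitrary elements of `ℓ²(X)`, as functions. -/
def formalA (h : BoundedRel r) (Φ : X → ℤ) (φ : EllTwo X) (x : X) : ℂ :=
  Complex.I * ((Φ x + 1 / 2) * relOp h φ x - (Φ x - 1 / 2) * relOp h.swap φ x)

theorem formalA_mulOp_sub (h : BoundedRel r) (Φ : X → ℤ) (m : X → ℂ) (hm : ∀ x, ‖m x‖ ≤ 1)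
    (φ : EllTwo X) (x : X) :
    formalA h Φ (EllTwo.mulOp m hm φ) x - m x * formalA h Φ φ x =
      Complex.I * ((Φ x + 1 / 2) * ∑ y ∈ (h.finite x).toFinset, (m y - m x) * φ y
        - (Φ x - 1 / 2) * ∑ y ∈ (h.swap.finite x).toFinset, (m y - m x) * φ y) := by
  rw [← relOp_mulOp_sub h m hm, ← relOp_mulOp_sub h.swap m hm, formalA, formalA]
  ring

/-- In the commutator with a cutoff, the unbounded factor `Φ` meets only differences of `m` along
edges, which `c` controls. The extra 1 is the half-integer shift times `‖m y - m x‖ ≤ 2`. -/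
theorem norm_formalA_mulOp_sub_le (h : BoundedRel r) (Φ : X → ℤ) (m : X → ℂ) (hm : ∀ x, ‖m x‖ ≤ 1)
    (φ : EllTwo X) (c : ℝ)
    (hc : ∀ x y, r x y ∨ r y x → φ y ≠ 0 → ‖(Φ x : ℂ)‖ * ‖m y - m x‖ ≤ c) (x : X) :
    ‖formalA h Φ (EllTwo.mulOp m hm φ) x - m x * formalA h Φ φ x‖ ≤
      (c + 1) * (∑ y ∈ (h.finite x).toFinset, ‖φ y‖ + ∑ y ∈ (h.swap.finite x).toFinset, ‖φ y‖) := by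
  have key : ∀ y, r x y ∨ r y x → ∀ a : ℂ, ‖a‖ ≤ 1 / 2 →
      ‖(Φ x + a) * ((m y - m x) * φ y)‖ ≤ (c + 1) * ‖φ y‖ := by
    intro y hy a ha
    by_cases h0 : φ y = 0
    · simp [h0]
    · rw [← mul_assoc, norm_mul]
      refine mul_le_mul_of_nonneg_right ?_ (norm_nonneg _)
      rw [add_mul]
      refine (norm_add_le _ _).trans (add_le_add ?_ ?_)
      · rw [norm_mul]; exact hc x y hy h0
      · rw [norm_mul]
        have : ‖m y - m x‖ ≤ 2 := (norm_sub_le _ _).trans (by linarith [hm x, hm y])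
        calc ‖a‖ * ‖m y - m x‖ ≤ (1 / 2) * 2 := by gcongr
          _ = 1 := by norm_num
  rw [formalA_mulOp_sub, norm_mul, Complex.norm_I, one_mul, mul_add, Finset.mul_sum, Finset.mul_sum,
    Finset.mul_sum, Finset.mul_sum]
  refine (norm_sub_le _ _).trans (add_le_add ?_ ?_)
  · refine (norm_sum_le _ _).trans (Finset.sum_le_sum fun y hy => ?_)
    exact key y (Or.inl (by simpa using hy)) _ (by norm_num)
  · refine (norm_sum_le _ _).trans (Finset.sum_le_sum fun y hy => ?_)
    rw [sub_eq_add_neg]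
    exact key y (Or.inr (by simpa using hy)) _ (by norm_num)

/-- The common limiting argument for both cutoffs. A uniformly bounded commutator with the cutoff
provides an `ℓ²` majorant `2|η| + (|c| + 1)(U|φ| + U*|φ|)`, so dominated convergence applies to `φ`
and to its image at once. -/
theorem mem_of_cutoff (h : BoundedRel r) (Φ : X → ℤ) {Γ : Set (EllTwo X × EllTwo X)}
    (hΓ : IsClosed Γ) {ι : Type*} {l : Filter ι} [l.NeBot] {m : ι → X → ℂ}
    (hm : ∀ i x, ‖m i x‖ ≤ 1) (hm1 : ∀ x, Tendsto (fun i => m i x) l (𝓝 1))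
    {φ η : EllTwo X} (hη : ∀ x, η x = formalA h Φ φ x) (c : ℝ)
    (hc : ∀ i x y, r x y ∨ r y x → φ y ≠ 0 → ‖(Φ x : ℂ)‖ * ‖m i y - m i x‖ ≤ c)
    (hmem : ∀ i, ∀ ζ : EllTwo X, (∀ x, ζ x = formalA h Φ (EllTwo.mulOp (m i) (hm i) φ) x) →
      (EllTwo.mulOp (m i) (hm i) φ, ζ) ∈ Γ) : (φ, η) ∈ Γ := by
  by_cases hι : Nonempty ι
  swap
  · have := l.nonempty_of_neBot; exact absurd this hι
  set g : EllTwo X := (2 : ℂ) • EllTwo.abs η +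
    ((|c| : ℝ) + 1 : ℂ) • (relOp h (EllTwo.abs φ) + relOp h.swap (EllTwo.abs φ)) with hg
  have hgx : ∀ x, ‖g x‖ = 2 * ‖η x‖ + (|c| + 1) * (∑ y ∈ (h.finite x).toFinset, ‖φ y‖ +
      ∑ y ∈ (h.swap.finite x).toFinset, ‖φ y‖) := by
    intro x
    have : g x = ((2 * ‖η x‖ + (|c| + 1) * (∑ y ∈ (h.finite x).toFinset, ‖φ y‖ +
      ∑ y ∈ (h.swap.finite x).toFinset, ‖φ y‖) : ℝ) : ℂ) := by
      have e : g x = (2 : ℂ) * EllTwo.abs η x +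
        ((|c| : ℝ) + 1 : ℂ) * (relOp h (EllTwo.abs φ) x + relOp h.swap (EllTwo.abs φ) x) := rfl
      rw [e, norm_relOp_abs, norm_relOp_abs, EllTwo.abs_apply]
      push_cast
      ring
    rw [this, Complex.norm_of_nonneg (by positivity)]
  have hbound : ∀ i x, ‖formalA h Φ (EllTwo.mulOp (m i) (hm i) φ) x - η x‖ ≤ ‖g x‖ := by
    intro i x
    have h1 := norm_formalA_mulOp_sub_le h Φ (m i) (hm i) φ |c|
      (fun x y hxy hy => (hc i x y hxy hy).trans (le_abs_self c)) x
    have h2 : ‖m i x * η x - η x‖ ≤ 2 * ‖η x‖ := by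
      refine (norm_sub_le _ _).trans ?_
      rw [norm_mul]
      nlinarith [hm i x, norm_nonneg (η x)]
    have h3 := norm_add_le (formalA h Φ (EllTwo.mulOp (m i) (hm i) φ) x - m i x * η x)
      (m i x * η x - η x)
    rw [sub_add_sub_cancel] at h3
    rw [← hη x] at h1
    rw [hgx]
    linarith
  -- `formalA` of the truncated function is a priori just a function; it lies in `ℓ²` because it
  -- differs from `η` by something dominated by `g`.
  let ζ : ι → EllTwo X := fun i => η + ⟨_, memℓp_of_norm_le g (hbound i)⟩
  have hζ : ∀ i x, ζ i x = formalA h Φ (EllTwo.mulOp (m i) (hm i) φ) x := by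
    intro i x
    change η x + (formalA h Φ (EllTwo.mulOp (m i) (hm i) φ) x - η x) = _
    ring
  have t1 : Tendsto (fun i => EllTwo.mulOp (m i) (hm i) φ) l (𝓝 φ) := by
    refine EllTwo.tendsto_of_dominated ((2 : ℂ) • φ) (fun x => ?_) (fun i x => ?_)
    · simpa [EllTwo.mulOp_apply] using (hm1 x).mul_const (φ x)
    · rw [EllTwo.mulOp_apply]
      refine (norm_sub_le _ _).trans ?_
      rw [norm_mul, lp.coeFn_smul, Pi.smul_apply, norm_smul]
      have : ‖(2 : ℂ)‖ = 2 := by norm_num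
      nlinarith [hm i x, norm_nonneg (φ x)]
  have t2 : Tendsto ζ l (𝓝 η) := by
    refine EllTwo.tendsto_of_dominated g (fun x => ?_) (fun i x => ?_)
    · simp_rw [hζ]
      have e : ∀ i, formalA h Φ (EllTwo.mulOp (m i) (hm i) φ) x = m i x * formalA h Φ φ x +
        Complex.I * ((Φ x + 1 / 2) * ∑ y ∈ (h.finite x).toFinset, (m i y - m i x) * φ y
        - (Φ x - 1 / 2) * ∑ y ∈ (h.swap.finite x).toFinset, (m i y - m i x) * φ y) := by
        intro i
        rw [← formalA_mulOp_sub h Φ (m i) (hm i)]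
        ring
      simp_rw [e]
      have s : ∀ F : Finset X, Tendsto (fun i => ∑ y ∈ F, (m i y - m i x) * φ y) l (𝓝 0) := by
        intro F
        have := tendsto_finsetSum F fun y _ => (((hm1 y).sub (hm1 x)).mul_const (φ y))
        simpa using this
      have := ((hm1 x).mul_const (formalA h Φ φ x)).add
        ((((s (h.finite x).toFinset).const_mul (Φ x + 1 / 2 : ℂ)).sub
          ((s (h.swap.finite x).toFinset).const_mul (Φ x - 1 / 2 : ℂ))).const_mul Complex.I)
      rw [hη]
      simpa using this
    · rw [hζ]; exact hbound i x
  exact hΓ.mem_of_tendsto (t1.prodMk_nhds t2) (Eventually.of_forall fun i => hmem i _ (hζ i))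

end EssentialSelfAdjointness

/-! ### Closures of symmetric operators -/

section ClosureOfSymmetric

variable {E : Type*} [NormedAddCommGroup E] [InnerProductSpace ℂ E] [CompleteSpace E]

/-- The adjoint is a closed extension. -/
theorem isClosable_of_symmetric {T : E →ₗ.[ℂ] E} (hd : Dense (T.domain : Set E))
    (hs : T.IsFormalAdjoint T) : T.IsClosable :=
  (LinearPMap.adjoint_isClosed hd).isClosable.leIsClosable (hs.le_adjoint hd)

/-- A densely defined symmetric operator whose closure extends its adjoint is essentially
self-adjoint. -/
theorem isSelfAdjoint_closure {T : E →ₗ.[ℂ] E} (hd : Dense (T.domain : Set E))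
    (hs : T.IsFormalAdjoint T)
    (hadj : ∀ ψ η : E, (∀ φ : T.domain, ⟪η, φ⟫_ℂ = ⟪ψ, T φ⟫_ℂ) →
      (ψ, η) ∈ closure (T.graph : Set (E × E))) : IsSelfAdjoint T.closure := by
  have hc := isClosable_of_symmetric hd hs
  have hd' : Dense (T.closure.domain : Set E) := hd.mono T.le_closure.1
  have hg : (T.closure.graph : Set (E × E)) = closure (T.graph : Set (E × E)) := by
    rw [← hc.graph_closure_eq_closure_graph]; rfl
  have hle : T.graph ≤ T.closure.graph := LinearPMap.le_graph_of_le T.le_closure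
  rw [LinearPMap.isSelfAdjoint_def]
  apply LinearPMap.eq_of_eq_graph
  rw [LinearPMap.adjoint_graph_eq_graph_adjoint hd']
  ext ⟨ψ, η⟩
  rw [Submodule.mem_adjoint_iff]
  constructor
  · intro h
    rw [← SetLike.mem_coe, hg]
    refine hadj ψ η fun φ => ?_
    have h1 := h φ (T φ) (hle (T.mem_graph φ))
    rw [sub_eq_zero] at h1
    rw [← inner_conj_symm, ← h1, inner_conj_symm]
  · intro h a b hab
    -- The symmetry relation passes to the closure of the graph one variable at a time, by
    -- continuity of the inner product.
    have h1 : ∀ p ∈ (T.graph : Set (E × E)), ∀ q ∈ closure (T.graph : Set (E × E)),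
        ⟪p.2, q.1⟫_ℂ - ⟪p.1, q.2⟫_ℂ = 0 := by
      intro p hp q hq
      refine closure_minimal (s := (T.graph : Set (E × E)))
        (t := {q | ⟪p.2, q.1⟫_ℂ - ⟪p.1, q.2⟫_ℂ = 0}) ?_ ?_ hq
      · intro q hq
        obtain ⟨x, hx1, hx2⟩ := (LinearPMap.mem_graph_iff _).1 hp
        obtain ⟨y, hy1, hy2⟩ := (LinearPMap.mem_graph_iff _).1 hq
        change ⟪p.2, q.1⟫_ℂ - ⟪p.1, q.2⟫_ℂ = 0
        rw [← hx1, ← hx2, ← hy1, ← hy2, hs x y, sub_self]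
      · exact isClosed_eq (by fun_prop) continuous_const
    rw [← SetLike.mem_coe, hg] at hab h
    refine closure_minimal (s := (T.graph : Set (E × E)))
        (t := {p | ⟪p.2, ψ⟫_ℂ - ⟪p.1, η⟫_ℂ = 0}) (fun p hp => h1 p hp _ h) ?_ hab
    exact isClosed_eq (by fun_prop) continuous_const

end ClosureOfSymmetric

/-! ### Self-adjointness of the conjugate operator -/

section ConjugateOperator

variable {X : Type*} {r : X → X → Prop}

theorem isSelfAdjoint_conjugateK (h : BoundedRel r) : IsSelfAdjoint (conjugateK h) := by
  rw [conjugateK_eq, IsSelfAdjoint]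
  simp [star_smul, star_sub]
  rw [← smul_neg, neg_sub]

theorem finMul_coe_apply (Φ : X → ℤ) (φ : finSupp X) (x : X) :
    (finMul Φ φ : EllTwo X) x = Φ x * (φ : EllTwo X) x := rfl

theorem conjugateK_apply (h : BoundedRel r) (φ : EllTwo X) (x : X) :
    conjugateK h φ x = Complex.I * (relOp h φ x - relOp h.swap φ x) := rfl

theorem preConjugateA_apply (h : BoundedRel r) (Φ : X → ℤ) (φ : finSupp X) :
    preConjugateA h Φ φ = (1 / 2 : ℂ) • ((finMul Φ (finK h φ) : EllTwo X) +
      conjugateK h (finMul Φ φ : EllTwo X)) := rfl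

/-- Moving `Φ` through a shift changes it by one, so averaging the two orders leaves the
half-integers `Φ ± ½`. -/
theorem preConjugateA_eq_formalA (h : BoundedRel r) {Φ : X → ℤ} (hΦ : IsPositionFunction r Φ)
    (φ : finSupp X) (x : X) : preConjugateA h Φ φ x = formalA h Φ φ x := by
  have e1 : relOp h (finMul Φ φ : EllTwo X) x = (Φ x + 1) * relOp h (φ : EllTwo X) x := by
    rw [relOp_apply_eq_sum, relOp_apply_eq_sum, Finset.mul_sum]
    refine Finset.sum_congr rfl fun y hy => ?_
    have : r x y := by simpa using hy
    rw [finMul_coe_apply, hΦ x y this]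
    push_cast
    rfl
  have e2 : relOp h.swap (finMul Φ φ : EllTwo X) x = (Φ x - 1) * relOp h.swap (φ : EllTwo X) x := by
    rw [relOp_apply_eq_sum, relOp_apply_eq_sum, Finset.mul_sum]
    refine Finset.sum_congr rfl fun y hy => ?_
    have : r y x := by simpa using hy
    rw [finMul_coe_apply, hΦ y x this]
    push_cast
    ring
  have e3 : preConjugateA h Φ φ x = 1 / 2 * (Φ x * conjugateK h (φ : EllTwo X) x +
      conjugateK h (finMul Φ φ : EllTwo X) x) := rfl
  rw [e3, conjugateK_apply, conjugateK_apply, e1, e2, formalA]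
  ring

theorem inner_finMul (Φ : X → ℤ) (φ ψ : finSupp X) :
    ⟪(finMul Φ φ : EllTwo X), (ψ : EllTwo X)⟫_ℂ = ⟪(φ : EllTwo X), (finMul Φ ψ : EllTwo X)⟫_ℂ := by
  rw [lp.inner_eq_tsum, lp.inner_eq_tsum]
  refine tsum_congr fun x => ?_
  rw [finMul_coe_apply, finMul_coe_apply]
  simp only [RCLike.inner_apply, map_mul, map_intCast]
  ring

theorem preConjugateA_isFormalAdjoint (h : BoundedRel r) (Φ : X → ℤ) :
    (preConjugateA h Φ).IsFormalAdjoint (preConjugateA h Φ) := by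
  intro (φ : finSupp X) (ψ : finSupp X)
  have hK : ∀ a b : EllTwo X, ⟪conjugateK h a, b⟫_ℂ = ⟪a, conjugateK h b⟫_ℂ := by
    intro a b
    nth_rw 1 [← (isSelfAdjoint_conjugateK h).star_eq]
    rw [ContinuousLinearMap.star_eq_adjoint, ContinuousLinearMap.adjoint_inner_left]
  rw [preConjugateA_apply, preConjugateA_apply, inner_smul_left, inner_smul_right, inner_add_left,
    inner_add_right, inner_finMul, ← inner_finMul Φ φ (finK h ψ)]
  have e : ∀ a : finSupp X, (finK h a : EllTwo X) = conjugateK h (a : EllTwo X) := fun _ => rfl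
  rw [e, e, hK, hK, add_comm]
  congr 1
  rw [map_div₀, map_one, map_ofNat]

/-- Indicators of finite sets serve as cutoffs: if `|Φ| ≤ N` on the support of `φ`, then `|Φ| ≤ N +
1` at adjacent vertices, which bounds the commutator. -/
theorem closure_graph_of_bounded_position (h : BoundedRel r) {Φ : X → ℤ}
    (hΦ : IsPositionFunction r Φ) {φ η : EllTwo X} (hη : ∀ x, η x = formalA h Φ φ x) (N : ℝ)
    (hN : ∀ x, φ x ≠ 0 → ‖(Φ x : ℂ)‖ ≤ N) :
    (φ, η) ∈ closure ((preConjugateA h Φ).graph : Set (EllTwo X × EllTwo X)) := by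
  classical
  refine mem_of_cutoff h Φ isClosed_closure (ι := Finset X) (l := atTop)
    (m := fun F x => if x ∈ F then 1 else 0) (fun F x => by split_ifs <;> simp) (fun x => ?_)
    hη (N + 1) ?_ ?_
  · refine tendsto_const_nhds.congr' ?_
    filter_upwards [eventually_ge_atTop {x}] with F hF
    rw [if_pos (hF (Finset.mem_singleton_self x))]
  · intro F x y hxy hy
    have h1 : ‖(Φ x : ℂ)‖ ≤ N + 1 := by
      have h2 : ‖(Φ x : ℂ)‖ ≤ ‖(Φ y : ℂ)‖ + 1 := by
        rcases hxy with hxy | hxy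
        · have : (Φ x : ℂ) = Φ y - 1 := by rw [hΦ x y hxy]; push_cast; ring
          rw [this]
          exact (norm_sub_le _ _).trans (by simp)
        · rw [hΦ y x hxy]
          push_cast
          exact (norm_add_le _ _).trans (by simp)
      linarith [hN y hy]
    have h2 : ‖(if y ∈ F then (1 : ℂ) else 0) - (if x ∈ F then (1 : ℂ) else 0)‖ ≤ 1 := by
      split_ifs <;> simp
    calc _ ≤ (N + 1) * 1 := mul_le_mul h1 h2 (norm_nonneg _) ((norm_nonneg _).trans h1)
      _ = N + 1 := mul_one _
  · intro F ζ hζ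
    refine subset_closure ?_
    have hF : EllTwo.mulOp (fun x => if x ∈ F then (1 : ℂ) else 0)
        (fun x => by split_ifs <;> simp) φ ∈ finSupp X := by
      refine F.finite_toSet.subset fun x hx => ?_
      by_contra hne
      apply hx
      have : x ∉ F := hne
      rw [EllTwo.mulOp_apply, if_neg this, zero_mul]
    refine (LinearPMap.mem_graph_iff _).2 ⟨⟨_, hF⟩, rfl, ?_⟩
    ext x
    rw [hζ]
    exact preConjugateA_eq_formalA h hΦ ⟨_, hF⟩ x

/-- The cutoff is a tent in `Φ` of half-width `N + 1`. Its slope `1/(N + 1)` compensates the growth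
of `Φ`, and the truncated function has bounded position, so the previous case applies to it. -/
theorem closure_graph_of_formalA (h : BoundedRel r) {Φ : X → ℤ}
    (hΦ : IsPositionFunction r Φ) {φ η : EllTwo X} (hη : ∀ x, η x = formalA h Φ φ x) :
    (φ, η) ∈ closure ((preConjugateA h Φ).graph : Set (EllTwo X × EllTwo X)) := by
  have hm : ∀ (N : ℕ) (x : X), ‖((max 0 (1 - |(Φ x : ℝ)| / (N + 1)) : ℝ) : ℂ)‖ ≤ 1 := by
    intro N x
    rw [Complex.norm_of_nonneg (le_max_left _ _)]
    refine max_le zero_le_one ?_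
    have : 0 ≤ |(Φ x : ℝ)| / (N + 1) := by positivity
    linarith
  refine mem_of_cutoff h Φ isClosed_closure (ι := ℕ) (l := atTop)
    (m := fun N x => ((max 0 (1 - |(Φ x : ℝ)| / (N + 1)) : ℝ) : ℂ)) hm (fun x => ?_) hη 2 ?_ ?_
  · have h1 : Tendsto (fun N : ℕ => |(Φ x : ℝ)| / ((N : ℝ) + 1)) atTop (𝓝 0) :=
      tendsto_const_div_atTop_nhds_zero_nat |(Φ x : ℝ)| |>.comp (tendsto_add_atTop_nat 1) |>.congr
        fun N => by simp
    have h2 : Tendsto (fun N : ℕ => max 0 (1 - |(Φ x : ℝ)| / ((N : ℝ) + 1))) atTop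
        (𝓝 (max 0 (1 - 0))) := tendsto_const_nhds.max (tendsto_const_nhds.sub h1)
    have h3 := (Complex.continuous_ofReal.tendsto _).comp h2
    simpa [Function.comp_def] using h3
  · intro N x y hxy _
    have hxy' : |(|(Φ y : ℝ)| - |(Φ x : ℝ)|)| ≤ 1 := by
      refine (abs_abs_sub_abs_le_abs_sub _ _).trans ?_
      rcases hxy with hxy | hxy
      · rw [hΦ x y hxy]; push_cast; simp
      · rw [hΦ y x hxy]; push_cast; simp
    have hn : ‖(Φ x : ℂ)‖ = |(Φ x : ℝ)| := by simp
    rw [hn, ← Complex.ofReal_sub, Complex.norm_real, Real.norm_eq_abs]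
    set a := |(Φ x : ℝ)|
    set b := |(Φ y : ℝ)|
    have hN : (0 : ℝ) < N + 1 := by positivity
    have hN0 : (0 : ℝ) ≤ N := by positivity
    have ha : 0 ≤ a := abs_nonneg _
    obtain ⟨l1, l2⟩ := abs_le.1 hxy'
    -- For `|Φ x| ≤ N + 2` the product is at most `(N + 2)/(N + 1) ≤ 2`; beyond that, both endpoints
    -- lie outside the tent and the difference is zero.
    rcases le_total a (N + 2) with h1 | h1
    · have h2 : |max 0 (1 - b / (N + 1)) - max 0 (1 - a / (N + 1))| ≤ 1 / (N + 1) := by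
        refine (abs_max_sub_max_le_max _ _ _ _).trans ?_
        rw [sub_self, abs_zero, max_eq_right (abs_nonneg _), sub_sub_sub_cancel_left, ← sub_div,
          abs_div, abs_of_pos hN, abs_sub_comm]
        gcongr
      calc _ ≤ (N + 2) * (1 / ((N : ℝ) + 1)) := mul_le_mul h1 h2 (abs_nonneg _) (by positivity)
        _ ≤ 2 := by rw [mul_one_div, div_le_iff₀ hN]; linarith
    · have e1 : max 0 (1 - b / (N + 1)) = 0 := by
        refine max_eq_left ?_
        rw [sub_nonpos, one_le_div hN]; linarith
      have e2 : max 0 (1 - a / (N + 1)) = 0 := by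
        refine max_eq_left ?_
        rw [sub_nonpos, one_le_div hN]; linarith
      rw [e1, e2]; simp
  · intro N ζ hζ
    refine closure_graph_of_bounded_position h hΦ hζ (N + 1) fun x hx => ?_
    by_contra! hlt
    apply hx
    have hn : ‖(Φ x : ℂ)‖ = |(Φ x : ℝ)| := by simp
    rw [hn] at hlt
    have hN : (0 : ℝ) < N + 1 := by positivity
    have e2 : max 0 (1 - |(Φ x : ℝ)| / (N + 1)) = 0 := by
      refine max_eq_left ?_
      rw [sub_nonpos, one_le_div hN]; linarith
    rw [EllTwo.mulOp_apply, e2]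
    simp

-- The half-integers change sign relative to `formalA` because `Φ` is now evaluated at `x` and not
-- at the neighbour where the image lives.
open Classical in
theorem preConjugateA_single (h : BoundedRel r) {Φ : X → ℤ} (hΦ : IsPositionFunction r Φ) (x : X) :
    preConjugateA h Φ ⟨lp.single 2 x 1, single_mem_finSupp x 1⟩ =
      Complex.I • ((Φ x - 1 / 2 : ℂ) • relOp h (lp.single 2 x 1) -
        (Φ x + 1 / 2 : ℂ) • relOp h.swap (lp.single 2 x 1)) := by
  ext y
  refine (preConjugateA_eq_formalA h hΦ _ y).trans ?_
  rw [formalA]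
  change _ = Complex.I * ((Φ x - 1 / 2 : ℂ) * relOp h (lp.single 2 x 1) y -
        (Φ x + 1 / 2 : ℂ) * relOp h.swap (lp.single 2 x 1) y)
  simp only [relOp_single]
  by_cases h1 : r y x <;> by_cases h2 : r x y
  · simp only [h1, h2, if_true]
    have a := hΦ _ _ h1
    have b := hΦ _ _ h2
    omega
  · simp only [h1, h2, if_true, if_false, hΦ _ _ h1]
    push_cast; ring
  · simp only [h1, h2, if_true, if_false, hΦ _ _ h2]
    push_cast; ring
  · simp [h1, h2]

theorem preConjugateA_isClosable (h : BoundedRel r) (Φ : X → ℤ) :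
    (preConjugateA h Φ).IsClosable :=
  isClosable_of_symmetric dense_finSupp (preConjugateA_isFormalAdjoint h Φ)

/-- Testing the adjoint relation on point masses shows that the adjoint acts by the formal
expression; such pairs already lie in the closure of the graph. -/
theorem isSelfAdjoint_conjugateA (h : BoundedRel r) {Φ : X → ℤ} (hΦ : IsPositionFunction r Φ) :
    IsSelfAdjoint (conjugateA h Φ) := by
  classical
  refine isSelfAdjoint_closure dense_finSupp (preConjugateA_isFormalAdjoint h Φ)
    fun ψ η hη => closure_graph_of_formalA h hΦ fun x => ?_
  have h1 := hη ⟨lp.single 2 x 1, single_mem_finSupp x 1⟩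
  rw [preConjugateA_single h hΦ, inner_smul_right, inner_sub_right, inner_smul_right,
    inner_smul_right] at h1
  have s1 : ∀ a, ⟪ψ, relOp h a⟫_ℂ = ⟪relOp h.swap ψ, a⟫_ℂ := fun a => by
    rw [← adjoint_relOp h, ContinuousLinearMap.star_eq_adjoint,
      ContinuousLinearMap.adjoint_inner_left]
  have s2 : ∀ a, ⟪ψ, relOp h.swap a⟫_ℂ = ⟪relOp h ψ, a⟫_ℂ := fun a => by
    rw [← adjoint_relOp h, ContinuousLinearMap.star_eq_adjoint,
      ContinuousLinearMap.adjoint_inner_right]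
  rw [s1, s2] at h1
  simp only [lp.inner_single_right] at h1
  have h2 := congrArg (starRingEnd ℂ) h1
  simp only [RCLike.inner_apply, map_mul, map_sub, map_add, map_one, Complex.conj_conj, map_div₀,
    map_ofNat, map_intCast, Complex.conj_I, one_mul] at h2
  rw [h2, formalA]
  ring

theorem graph_conjugateA (h : BoundedRel r) (Φ : X → ℤ) :
    ((conjugateA h Φ).graph : Set (EllTwo X × EllTwo X)) =
      closure ((preConjugateA h Φ).graph : Set (EllTwo X × EllTwo X)) := by
  rw [conjugateA, ← (preConjugateA_isClosable h Φ).graph_closure_eq_closure_graph]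
  rfl

end ConjugateOperator

/-! ### Bounded commutators and `C¹` regularity -/

section Commutators

variable {E : Type*} [NormedAddCommGroup E] [InnerProductSpace ℂ E]

/-- `S` preserves the domain of `A`, and `A S = S A + C` there. -/
def HasCommutator (A : E →ₗ.[ℂ] E) (S C : E →L[ℂ] E) : Prop :=
  ∀ p ∈ A.graph, (S p.1, S p.2 + C p.1) ∈ A.graph

namespace HasCommutator

variable {A : E →ₗ.[ℂ] E} {S T C B : E →L[ℂ] E}

theorem congr {C' : E →L[ℂ] E} (h : HasCommutator A S C) (hC : C = C') :
    HasCommutator A S C' := hC ▸ h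

theorem smul_one (a : ℂ) : HasCommutator A (a • 1) 0 := by
  intro p hp
  simpa using A.graph.smul_mem a hp

theorem add (hS : HasCommutator A S C) (hT : HasCommutator A T B) :
    HasCommutator A (S + T) (C + B) := by
  intro p hp
  convert A.graph.add_mem (hS p hp) (hT p hp) using 1
  simp only [add_apply, Prod.mk_add_mk]
  congr 1
  abel

theorem smul (a : ℂ) (hS : HasCommutator A S C) : HasCommutator A (a • S) (a • C) := by
  intro p hp
  simpa using A.graph.smul_mem a (hS p hp)

theorem mul (hS : HasCommutator A S C) (hT : HasCommutator A T B) :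
    HasCommutator A (S * T) (S * B + C * T) := by
  intro p hp
  have h2 := hS _ (hT p hp)
  have e : S (T p.2 + B p.1) + C (T p.1) = (S * T) p.2 + (S * B + C * T) p.1 := by
    rw [map_add, add_assoc]
    rfl
  rwa [e] at h2

/-- The map `(u, v) ↦ (Su, Sv + Cu)` is continuous, so invariance of a graph passes to its closure.
-/
theorem of_core {T₀ : E →ₗ.[ℂ] E} (hA : (A.graph : Set (E × E)) = closure (T₀.graph : Set (E × E)))
    (h : ∀ p ∈ T₀.graph, (S p.1, S p.2 + C p.1) ∈ T₀.graph) : HasCommutator A S C := by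
  intro p hp
  rw [← SetLike.mem_coe, hA] at hp ⊢
  exact map_mem_closure (f := fun q : E × E => (S q.1, S q.2 + C q.1)) (by fun_prop) hp
    fun q hq => h q hq

theorem of_tendsto (hA : A.IsClosed) {ι : Type*} {l : Filter ι} [l.NeBot]
    {Sn Cn : ι → E →L[ℂ] E} (h : ∀ i, HasCommutator A (Sn i) (Cn i))
    (hS : Tendsto Sn l (𝓝 S)) (hC : Tendsto Cn l (𝓝 C)) : HasCommutator A S C := by
  intro p hp
  have ev : ∀ x : E, Continuous fun R : E →L[ℂ] E => R x := fun x => by fun_prop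
  have t1 := ((ev p.1).tendsto S).comp hS
  have t2 := (((ev p.2).tendsto S).comp hS).add (((ev p.1).tendsto C).comp hC)
  exact hA.mem_of_tendsto (t1.prodMk_nhds t2) (Eventually.of_forall fun i => h i p hp)

/-- The Leibniz rule collapses to the chain rule because `C` commutes with `T`. -/
theorem aeval (hT : HasCommutator A T C) (hTC : Commute T C) (p : Polynomial ℂ) :
    HasCommutator A (Polynomial.aeval T p) (Polynomial.aeval T p.derivative * C) := by
  induction p using Polynomial.induction_on with
  | C a => simpa [Algebra.algebraMap_eq_smul_one] using smul_one a
  | add p q hp hq =>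
    rw [map_add, map_add, map_add, add_mul]
    exact hp.add hq
  | monomial n a h =>
    rw [pow_succ, ← mul_assoc, map_mul, Polynomial.aeval_X]
    refine (h.mul hT).congr ?_
    rw [Polynomial.derivative_mul (g := Polynomial.X), Polynomial.derivative_X, mul_one, map_add,
      map_mul _ _ Polynomial.X, Polynomial.aeval_X, mul_assoc _ C, ← hTC.eq]
    noncomm_ring

theorem map_domain (h : HasCommutator A S C) {φ : E} (hφ : φ ∈ A.domain) : S φ ∈ A.domain :=
  LinearPMap.mem_domain_of_mem_graph (h _ (A.mem_graph ⟨φ, hφ⟩))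

variable [CompleteSpace E]

/-- Here `C` plays the role of `[A, S]`, whence the factor in `[iS, A] = -iC`. -/
theorem isCommutator (hA : IsSelfAdjoint A) (h : HasCommutator A S C) :
    IsCommutator A S (-Complex.I • C) := by
  intro φ
  obtain ⟨y, hy1, hy2⟩ := (LinearPMap.mem_graph_iff _).1 (h _ (A.mem_graph φ))
  have h1 : ⟪A φ, S (φ : E)⟫_ℂ = ⟪(φ : E), S (A φ) + C φ⟫_ℂ := by
    have h2 := LinearPMap.adjoint_isFormalAdjoint hA.dense_domain
    rw [LinearPMap.isSelfAdjoint_def.1 hA] at h2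
    have h3 := h2 φ y
    rw [hy1, hy2] at h3
    exact h3
  rw [inner_smul_right, inner_smul_right, h1, inner_add_right, smul_apply,
    inner_smul_right]
  ring

end HasCommutator

/-! ### Strong differentiability of `t ↦ W (-t) S (W t φ)` -/

namespace IsUnitaryGroupOf

variable [CompleteSpace E] {A : E →ₗ.[ℂ] E} {W : ℝ → E →L[ℂ] E}

theorem star_eq (hW : IsUnitaryGroupOf A W) (t : ℝ) : star (W t) = W (-t) := by
  have h1 : W t * W (-t) = 1 := by rw [← hW.map_add, add_neg_cancel, hW.map_zero]
  exact left_inv_eq_right_inv (Unitary.star_mul_self_of_mem (hW.unitary t)) h1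

theorem norm_apply (hW : IsUnitaryGroupOf A W) (t : ℝ) (φ : E) : ‖W t φ‖ = ‖φ‖ :=
  ContinuousLinearMap.norm_map_of_mem_unitary (hW.unitary t) φ

theorem inner_left (hW : IsUnitaryGroupOf A W) (t : ℝ) (φ ψ : E) :
    ⟪W t φ, ψ⟫_ℂ = ⟪φ, W (-t) ψ⟫_ℂ := by
  rw [← hW.star_eq, ContinuousLinearMap.star_eq_adjoint, ContinuousLinearMap.adjoint_inner_right]

theorem hasDerivAt (hW : IsUnitaryGroupOf A W) {φ ψ : E} (h : (φ, ψ) ∈ A.graph) (t : ℝ) :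
    HasDerivAt (fun s : ℝ => W s φ) (W t (Complex.I • ψ)) t := by
  have h0 := (hW.generator φ ψ).1 h
  have h1 : HasDerivAt (fun s : ℝ => W (s - t) φ) (Complex.I • ψ) t := by
    have := HasDerivAt.comp_sub_const (f := fun s : ℝ => W s φ) (f' := Complex.I • ψ) t t
      (by rwa [sub_self])
    exact this
  have h2 := ((W t).restrictScalars ℝ).hasFDerivAt.comp_hasDerivAt t h1
  refine h2.congr_of_eventuallyEq (Eventually.of_forall fun s => ?_)
  change W s φ = W t (W (s - t) φ)
  rw [← mul_apply_eq_comp, ← hW.map_add, add_sub_cancel]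

theorem mem_graph (hW : IsUnitaryGroupOf A W) {φ ψ : E} (h : (φ, ψ) ∈ A.graph) (t : ℝ) :
    (W t φ, W t ψ) ∈ A.graph := by
  refine (hW.generator _ _).2 ?_
  have h0 := (hW.generator φ ψ).1 h
  have h2 := ((W t).restrictScalars ℝ).hasFDerivAt.comp_hasDerivAt 0 h0
  rw [← map_smul]
  refine h2.congr_of_eventuallyEq (Eventually.of_forall fun s => ?_)
  change W s (W t φ) = W t (W s φ)
  rw [← mul_apply_eq_comp, ← mul_apply_eq_comp, ← hW.map_add, ← hW.map_add, add_comm]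

theorem continuous_neg_apply (hW : IsUnitaryGroupOf A W) {u : ℝ → E} (hu : Continuous u) :
    Continuous fun t : ℝ => W (-t) (u t) := by
  rw [continuous_iff_continuousAt]
  intro t₀
  have h1 : Tendsto (fun t : ℝ => W (-t) (u t₀)) (𝓝 t₀) (𝓝 (W (-t₀) (u t₀))) :=
    ((hW.continuous (u t₀)).comp continuous_neg).tendsto t₀
  have h2 : Tendsto (fun t : ℝ => W (-t) (u t - u t₀)) (𝓝 t₀) (𝓝 0) := by
    rw [tendsto_zero_iff_norm_tendsto_zero]
    simp_rw [hW.norm_apply]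
    rw [← tendsto_zero_iff_norm_tendsto_zero]
    have := (hu.tendsto t₀).sub_const (u t₀)
    rwa [sub_self] at this
  have h3 := h2.add h1
  rw [zero_add] at h3
  refine h3.congr fun t => ?_
  rw [map_sub, sub_add_cancel]

theorem continuous_conj (hW : IsUnitaryGroupOf A W) (S : E →L[ℂ] E) (φ : E) :
    Continuous fun t : ℝ => W (-t) (S (W t φ)) :=
  hW.continuous_neg_apply (S.continuous.comp (hW.continuous φ))

/-- For `φ` and `ψ` in the domain, `⟨W s ψ, S W s φ⟩` is differentiable and the commutator identity
evaluates its derivative. Integrating gives the identity weakly on the domain; the integrated form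
extends to all vectors by density, which the differentiated one would not directly do. -/
theorem conj_eq_integral (hW : IsUnitaryGroupOf A W) (hA : IsSelfAdjoint A) {S C : E →L[ℂ] E}
    (h : HasCommutator A S C) (t : ℝ) (φ : E) :
    W (-t) (S (W t φ)) = S φ + ∫ s in (0 : ℝ)..t, W (-s) ((-Complex.I • C) (W s φ)) := by
  set B : E →L[ℂ] E := -Complex.I • C with hB
  have hsymm := LinearPMap.adjoint_isFormalAdjoint hA.dense_domain
  rw [LinearPMap.isSelfAdjoint_def.1 hA] at hsymm
  have hdom : ∀ φ ∈ A.domain,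
      W (-t) (S (W t φ)) = S φ + ∫ s in (0 : ℝ)..t, W (-s) (B (W s φ)) := by
    intro φ hφ
    refine hA.dense_domain.eq_of_inner_right ℂ fun ψ hψ => ?_
    have gφ := A.mem_graph ⟨φ, hφ⟩
    have gψ := A.mem_graph ⟨ψ, hψ⟩
    have hder : ∀ s : ℝ, HasDerivAt (fun s : ℝ => ⟪W s ψ, S (W s φ)⟫_ℂ)
        ⟪ψ, W (-s) (B (W s φ))⟫_ℂ s := by
      intro s
      have d1 := hW.hasDerivAt gψ s
      have d2 := (S.restrictScalars ℝ).hasFDerivAt.comp_hasDerivAt s (hW.hasDerivAt gφ s)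
      have d3 := d1.inner ℂ d2
      refine d3.congr_deriv ?_
      obtain ⟨y, hy1, hy2⟩ := (LinearPMap.mem_graph_iff _).1 (h _ (hW.mem_graph gφ s))
      obtain ⟨z, hz1, hz2⟩ := (LinearPMap.mem_graph_iff _).1 (hW.mem_graph gψ s)
      have e := hsymm z y
      rw [hy1, hy2, hz1, hz2] at e
      change ⟪W s ψ, S (W s (Complex.I • _))⟫_ℂ + ⟪W s (Complex.I • _), S (W s φ)⟫_ℂ = _
      simp only [map_smul, inner_smul_left, inner_smul_right, Complex.conj_I] at e ⊢
      rw [e, ← hW.inner_left, inner_add_right, hB, smul_apply, inner_smul_right]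
      ring
    have hint := intervalIntegral.integral_eq_sub_of_hasDerivAt (a := 0) (b := t)
      (fun s _ => hder s)
      ((continuous_const.inner (hW.continuous_conj B φ)).intervalIntegrable _ _)
    rw [inner_add_right, ← hW.inner_left]
    have e2 : ⟪ψ, ∫ s in (0 : ℝ)..t, W (-s) (B (W s φ))⟫_ℂ =
        ∫ s in (0 : ℝ)..t, ⟪ψ, W (-s) (B (W s φ))⟫_ℂ :=
      (((innerSL ℂ ψ).restrictScalars ℝ).intervalIntegral_comp_comm
        ((hW.continuous_conj B φ).intervalIntegrable 0 t)).symm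
    rw [e2, hint, hW.map_zero]
    simp
  have hcl : IsClosed {φ : E | W (-t) (S (W t φ)) =
      S φ + ∫ s in (0 : ℝ)..t, W (-s) (B (W s φ))} := by
    refine isClosed_eq (by fun_prop) (S.continuous.add ?_)
    -- Since `W` is isometric, the integral is Lipschitz in `φ` with constant `‖B‖ |t|`.
    refine (LipschitzWith.of_dist_le_mul (K := ⟨‖B‖ * |t - 0|, by positivity⟩) fun φ ψ => ?_).continuous
    rw [dist_eq_norm, ← intervalIntegral.integral_sub
      ((hW.continuous_conj B φ).intervalIntegrable 0 t)
      ((hW.continuous_conj B ψ).intervalIntegrable 0 t)]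
    refine (intervalIntegral.norm_integral_le_of_norm_le_const (C := ‖B‖ * ‖φ - ψ‖)
      fun s _ => ?_).trans (le_of_eq ?_)
    · rw [← map_sub, ← map_sub, ← map_sub, hW.norm_apply]
      refine (B.le_opNorm _).trans ?_
      rw [hW.norm_apply]
    · rw [dist_eq_norm]
      change _ = ‖B‖ * |t - 0| * _
      ring
  exact closure_minimal (s := (A.domain : Set E)) hdom hcl (hA.dense_domain φ)

end IsUnitaryGroupOf

theorem HasCommutator.memC1 [CompleteSpace E] {A : E →ₗ.[ℂ] E} (hA : IsSelfAdjoint A) {S C : E →L[ℂ] E}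
    (h : HasCommutator A S C) : MemC1 A S := by
  refine ⟨⟨_, h.isCommutator hA⟩, fun W hW φ => ?_⟩
  have hc := hW.continuous_conj (-Complex.I • C) φ
  have hd : ∀ t, HasDerivAt (fun t : ℝ => W (-t) (S (W t φ)))
      (W (-t) ((-Complex.I • C) (W t φ))) t := by
    intro t
    have := (hc.integral_hasStrictDerivAt 0 t).hasDerivAt.const_add (S φ)
    exact this.congr_of_eventuallyEq (Eventually.of_forall fun s => hW.conj_eq_integral hA h s φ)
  rw [contDiff_one_iff_deriv]
  refine ⟨fun t => (hd t).differentiableAt, ?_⟩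
  have : deriv (fun t : ℝ => W (-t) (S (W t φ))) = fun t => W (-t) ((-Complex.I • C) (W t φ)) :=
    funext fun t => (hd t).deriv
  rwa [this]

end Commutators

/-! ## Functional calculus of a bounded self-adjoint operator -/

section Polynomials

open Polynomial

theorem exists_polynomial_near {f : ℝ → ℂ} (hf : Continuous f) (M : ℝ) {ε : ℝ} (hε : 0 < ε) :
    ∃ p : ℂ[X], ∀ x : ℝ, |x| ≤ M → ‖p.eval (x : ℂ) - f x‖ ≤ ε := by
  obtain ⟨p, hp⟩ := exists_polynomial_near_of_continuousOn (-M) M (fun x => (f x).re)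
    (Complex.continuous_re.comp hf).continuousOn (ε / 2) (by positivity)
  obtain ⟨q, hq⟩ := exists_polynomial_near_of_continuousOn (-M) M (fun x => (f x).im)
    (Complex.continuous_im.comp hf).continuousOn (ε / 2) (by positivity)
  refine ⟨p.map Complex.ofRealHom + C Complex.I * q.map Complex.ofRealHom, fun x hx => ?_⟩
  have e : ∀ s : ℝ[X], (s.map Complex.ofRealHom).eval (x : ℂ) = ((s.eval x : ℝ) : ℂ) := by
    intro s
    exact eval_map_apply (f := Complex.ofRealHom) (p := s) x
  rw [eval_add, eval_mul, eval_C, e, e]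
  have e2 : ((p.eval x : ℝ) : ℂ) + Complex.I * ((q.eval x : ℝ) : ℂ) - f x =
      ((p.eval x - (f x).re : ℝ) : ℂ) + Complex.I * ((q.eval x - (f x).im : ℝ) : ℂ) := by
    conv_lhs => rw [← Complex.re_add_im (f x)]
    push_cast
    ring
  rw [e2]
  refine (norm_add_le _ _).trans ?_
  rw [norm_mul, Complex.norm_I, one_mul, Complex.norm_real, Complex.norm_real, Real.norm_eq_abs,
    Real.norm_eq_abs]
  linarith [hp x (abs_le.1 hx), hq x (abs_le.1 hx)]

theorem exists_derivative_eq (p : ℂ[X]) : ∃ q : ℂ[X], derivative q = p := by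
  induction p using Polynomial.induction_on' with
  | add p q hp hq =>
    obtain ⟨a, rfl⟩ := hp
    obtain ⟨b, rfl⟩ := hq
    exact ⟨a + b, derivative_add⟩
  | monomial n a =>
    refine ⟨monomial (n + 1) (a / (n + 1)), ?_⟩
    have : (n : ℂ) + 1 ≠ 0 := by exact_mod_cast n.succ_ne_zero
    rw [derivative_monomial]
    simp [this]

/-- The derivative is approximated first and then integrated from 0. The tolerance `ε/(M + 1)`
serves both bounds and is meaningful even for `M = 0`. -/
theorem exists_polynomial_near_deriv {f f' : ℝ → ℂ} (hf : ∀ x, HasDerivAt f (f' x) x)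
    (hf' : Continuous f') {M : ℝ} (hM : 0 ≤ M) {ε : ℝ} (hε : 0 < ε) :
    ∃ p : ℂ[X], ∀ x : ℝ, |x| ≤ M → ‖p.eval (x : ℂ) - f x‖ ≤ ε ∧
      ‖(derivative p).eval (x : ℂ) - f' x‖ ≤ ε := by
  set δ := ε / (M + 1) with hδ
  have hδ0 : 0 < δ := by positivity
  have hδM : δ * M ≤ ε := by
    rw [hδ, div_mul_eq_mul_div, div_le_iff₀ (by positivity)]; nlinarith
  have hδε : δ ≤ ε := div_le_self hε.le (by linarith)
  obtain ⟨q, hq⟩ := exists_polynomial_near hf' M hδ0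
  obtain ⟨p, rfl⟩ := exists_derivative_eq q
  refine ⟨p + C (f 0 - p.eval 0), fun x hx => ⟨?_, ?_⟩⟩
  · have hd : ∀ y ∈ Set.Icc (-M) M, HasDerivWithinAt (fun y : ℝ => p.eval (y : ℂ) - f y)
        ((derivative p).eval (y : ℂ) - f' y) (Set.Icc (-M) M) y := fun y _ =>
      (((p.hasDerivAt (y : ℂ)).comp_ofReal).sub (hf y)).hasDerivWithinAt
    have := (convex_Icc (-M) M).norm_image_sub_le_of_norm_hasDerivWithin_le (C := δ) hd
      (fun y hy => hq y (abs_le.2 hy)) (x := 0) (y := x) ⟨by linarith, hM⟩ (abs_le.1 hx)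
    rw [eval_add, eval_C]
    have e : p.eval (x : ℂ) + (f 0 - p.eval 0) - f x =
        p.eval (x : ℂ) - f x - (p.eval ((0 : ℝ) : ℂ) - f 0) := by
      rw [Complex.ofReal_zero]; ring
    rw [e]
    refine this.trans (le_trans ?_ hδM)
    rw [sub_zero, Real.norm_eq_abs]
    gcongr
  · rw [derivative_add, derivative_C, add_zero]
    exact (hq x hx).trans hδε

end Polynomials

theorem commute_ringInverse {R : Type*} [Ring R] {a b : R} (h : Commute a b) :
    Commute a (Ring.inverse b) := by
  by_cases hb : IsUnit b
  · obtain ⟨u, rfl⟩ := hb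
    rw [Ring.inverse_unit]
    exact h.units_inv_right
  · rw [Ring.inverse_non_unit _ hb]
    exact Commute.zero_right a

theorem add_I_mul_sub_I {E : Type*} [NormedAddCommGroup E] [InnerProductSpace ℂ E] (H : E →L[ℂ] E) :
    (H + Complex.I • (1 : E →L[ℂ] E)) * (H - Complex.I • (1 : E →L[ℂ] E)) = H ^ 2 + 1 := by
  rw [add_mul, mul_sub, mul_sub, smul_mul_assoc, one_mul, mul_smul_comm, mul_one, smul_mul_assoc,
    one_mul, smul_smul, Complex.I_mul_I, sq, neg_one_smul]
  abel

section RealCalculus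

variable {E : Type*} [NormedAddCommGroup E] [InnerProductSpace ℂ E] [CompleteSpace E]

/-- The spectrum is real and bounded by `‖T‖ * ‖1‖`; keeping the factor `‖1‖` allows the zero space.
-/
theorem norm_aeval_sub_realCalculus_le {T : E →L[ℂ] E} (hT : IsSelfAdjoint T) {f : ℝ → ℂ}
    (hf : Continuous f) (p : Polynomial ℂ) {ε : ℝ} (hε : 0 ≤ ε)
    (h : ∀ x : ℝ, |x| ≤ ‖T‖ * ‖(1 : E →L[ℂ] E)‖ → ‖p.eval (x : ℂ) - f x‖ ≤ ε) :
    ‖Polynomial.aeval T p - realCalculus f T‖ ≤ ε := by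
  have hN : IsStarNormal T := hT.isStarNormal
  have hfc : Continuous fun z : ℂ => f z.re := hf.comp Complex.continuous_re
  rw [realCalculus, ← cfc_polynomial p T, ← cfc_sub _ _ T]
  refine norm_cfc_le hε fun z hz => ?_
  have hz1 := spectrum.norm_le_norm_mul_of_mem hz
  have hz2 : z = (z.re : ℂ) := hT.mem_spectrum_eq_re hz
  rw [hz2, Complex.norm_real] at hz1
  have := h z.re hz1
  rwa [← hz2] at this

theorem tendsto_aeval_realCalculus {T : E →L[ℂ] E} (hT : IsSelfAdjoint T) {f : ℝ → ℂ}
    (hf : Continuous f) {p : ℕ → Polynomial ℂ}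
    (h : ∀ (n : ℕ) (x : ℝ), |x| ≤ ‖T‖ * ‖(1 : E →L[ℂ] E)‖ →
      ‖(p n).eval (x : ℂ) - f x‖ ≤ 1 / ((n : ℝ) + 1)) :
    Tendsto (fun n => Polynomial.aeval T (p n)) atTop (𝓝 (realCalculus f T)) := by
  rw [tendsto_iff_norm_sub_tendsto_zero]
  exact squeeze_zero (fun _ => norm_nonneg _) (fun n =>
    norm_aeval_sub_realCalculus_le hT hf (p n) (by positivity) (h n))
    tendsto_one_div_add_atTop_nhds_zero_nat

/-- Polynomials converging to `f` together with their derivatives make both the operators and their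
commutators converge in norm, and the graph of `A` is closed. -/
theorem HasCommutator.realCalculus {A : E →ₗ.[ℂ] E} (hA : A.IsClosed) {T C : E →L[ℂ] E}
    (hT : IsSelfAdjoint T) (hTC : Commute T C) (h : HasCommutator A T C) {f f' : ℝ → ℂ}
    (hf : ∀ x, HasDerivAt f (f' x) x) (hf' : Continuous f') :
    HasCommutator A (realCalculus f T) (realCalculus f' T * C) := by
  have hfc : Continuous f := continuous_iff_continuousAt.2 fun x => (hf x).continuousAt
  choose p hp using fun n : ℕ => exists_polynomial_near_deriv hf hf'
    (by positivity : 0 ≤ ‖T‖ * ‖(1 : E →L[ℂ] E)‖) (by positivity : (0 : ℝ) < 1 / ((n : ℝ) + 1))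
  exact HasCommutator.of_tendsto hA (l := atTop) (fun n => h.aeval hTC (p n))
    (tendsto_aeval_realCalculus hT hfc fun n x hx => (hp n x hx).1)
    ((tendsto_aeval_realCalculus hT hf' fun n x hx => (hp n x hx).2).mul_const C)

/-- The functional calculus is compatible with intertwining maps. -/
theorem realCalculus_intertwine {F : Type*} [NormedAddCommGroup F] [InnerProductSpace ℂ F]
    [CompleteSpace F] {S : F →L[ℂ] F} {T : E →L[ℂ] E} (hS : IsSelfAdjoint S) (hT : IsSelfAdjoint T)
    (J : F →L[ℂ] E) (hJ : ∀ x, J (S x) = T (J x)) {f : ℝ → ℂ} (hf : Continuous f) (x : F) :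
    J (realCalculus f S x) = realCalculus f T (J x) := by
  choose p hp using fun n : ℕ => exists_polynomial_near hf
    (max (‖S‖ * ‖(1 : F →L[ℂ] F)‖) (‖T‖ * ‖(1 : E →L[ℂ] E)‖))
    (by positivity : (0 : ℝ) < 1 / ((n : ℝ) + 1))
  have t1 := tendsto_aeval_realCalculus hS hf fun n x hx => hp n x (hx.trans (le_max_left _ _))
  have t2 := tendsto_aeval_realCalculus hT hf fun n x hx => hp n x (hx.trans (le_max_right _ _))
  have e : ∀ (p : Polynomial ℂ) (x : F), J (Polynomial.aeval S p x) = Polynomial.aeval T p (J x) := by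
    intro p
    induction p using Polynomial.induction_on with
    | C a => intro x; simp [Algebra.algebraMap_eq_smul_one]
    | add p q hp hq => intro x; simp [hp, hq]
    | monomial n a h =>
      intro x
      rw [pow_succ, ← mul_assoc, map_mul, map_mul _ _ Polynomial.X, Polynomial.aeval_X,
        Polynomial.aeval_X, mul_apply_eq_comp, mul_apply_eq_comp, h, hJ]
  have evF : Continuous fun R : F →L[ℂ] F => J (R x) := by fun_prop
  have evE : Continuous fun R : E →L[ℂ] E => R (J x) := by fun_prop
  refine tendsto_nhds_unique ((evF.tendsto _).comp t1) ?_
  refine ((evE.tendsto _).comp t2).congr fun n => ?_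
  exact (e (p n) x).symm

theorem isUnit_add_smul_one {H : E →L[ℂ] E} (hH : IsSelfAdjoint H) {c : ℂ} (hc : c.im ≠ 0) :
    IsUnit (H + c • (1 : E →L[ℂ] E)) := by
  have h1 : -c ∉ spectrum ℂ H := by
    intro h
    have := hH.mem_spectrum_eq_re h
    have h2 := congrArg Complex.im this
    simp at h2
    exact hc h2
  rw [spectrum.notMem_iff] at h1
  have h2 := h1.neg
  rwa [Algebra.algebraMap_eq_smul_one, neg_sub, neg_smul, sub_neg_eq_add] at h2

theorem isUnit_sq_add_one {H : E →L[ℂ] E} (hH : IsSelfAdjoint H) : IsUnit (H ^ 2 + 1) := by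
  rw [← add_I_mul_sub_I, sub_eq_add_neg, ← neg_smul]
  exact (isUnit_add_smul_one hH (by simp)).mul (isUnit_add_smul_one hH (by simp))

theorem inverse_sq_add_one_eq {H : E →L[ℂ] E} (hH : IsSelfAdjoint H) :
    Ring.inverse (H ^ 2 + 1) = realCalculus (fun x => (((x ^ 2 + 1 : ℝ) : ℂ))⁻¹) H := by
  have hN : IsStarNormal H := hH.isStarNormal
  have hc : Continuous fun z : ℂ => ((z.re ^ 2 + 1 : ℝ) : ℂ) := by fun_prop
  rw [realCalculus, cfc_inv (fun z : ℂ => ((z.re ^ 2 + 1 : ℝ) : ℂ)) H]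
  · congr 1
    have h1 := cfc_polynomial (R := ℂ) (Polynomial.X ^ 2 + 1) H
    rw [map_add, map_pow, Polynomial.aeval_X, map_one] at h1
    rw [← h1]
    refine cfc_congr fun z hz => ?_
    have hz2 : z = (z.re : ℂ) := hH.mem_spectrum_eq_re hz
    change Polynomial.eval z _ = _
    rw [hz2]
    simp
  · intro z _ h
    rw [Complex.ofReal_eq_zero] at h
    nlinarith [sq_nonneg z.re]

/-- If `[iH, A]` commutes with `H`, then the averages defining the degree are constant. -/
theorem isDegree_of_commute {H C : E →L[ℂ] E} {A : E →ₗ.[ℂ] E}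
    (hC : Commute C H) (hcomm : IsCommutator A H C) :
    IsDegree H A (C * Ring.inverse (H ^ 2 + 1)) := by
  refine ⟨C, hcomm, fun φ => ?_⟩
  have hexp : ∀ (s : ℝ) (S : E →L[ℂ] E), Commute S H → Commute S (expI H s) := fun s S hS =>
    Commute.exp_right (hS.smul_right _)
  have hexp2 : ∀ s : ℝ, expI H s * expI H (-s) = 1 := by
    intro s
    let _ : NormedAlgebra ℚ (E →L[ℂ] E) := NormedAlgebra.restrictScalars ℚ ℂ _
    rw [expI, expI, ← NormedSpace.exp_add_of_commute]
    · simp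
    · exact ((Commute.refl H).smul_left _).smul_right _
  have key : ∀ S : E →L[ℂ] E, Commute S H →
      Commute S (Ring.inverse (H + Complex.I • (1 : E →L[ℂ] E))) ∧
      Commute S (Ring.inverse (H - Complex.I • (1 : E →L[ℂ] E))) := fun S hS =>
    ⟨commute_ringInverse (hS.add_right ((Commute.one_right S).smul_right _)),
     commute_ringInverse (hS.sub_right ((Commute.one_right S).smul_right _))⟩
  have c1 : Commute (H + Complex.I • (1 : E →L[ℂ] E)) H :=
    (Commute.refl H).add_left ((Commute.one_left H).smul_left _)
  have hinv : Ring.inverse (H ^ 2 + 1) = Ring.inverse (H + Complex.I • (1 : E →L[ℂ] E)) *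
      Ring.inverse (H - Complex.I • (1 : E →L[ℂ] E)) := by
    rw [← add_I_mul_sub_I, Ring.mul_inverse_rev' (c1.sub_right ((Commute.one_right _).smul_right _))]
    exact (commute_ringInverse (key _ c1).2.symm).eq
  have hconst : ∀ s : ℝ, expI H s * Ring.inverse (H + Complex.I • (1 : E →L[ℂ] E)) * C *
      Ring.inverse (H - Complex.I • (1 : E →L[ℂ] E)) * expI H (-s) =
      C * Ring.inverse (H ^ 2 + 1) := by
    intro s
    rw [hinv]
    have k1 := key _ (hexp (-s) H (Commute.refl H)).symm
    have k2 := (key _ hC).1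
    have k3 := hexp (-s) C hC
    generalize Ring.inverse (H + Complex.I • (1 : E →L[ℂ] E)) = a at *
    generalize Ring.inverse (H - Complex.I • (1 : E →L[ℂ] E)) = b at *
    have k4 : Commute (a * C * b) (expI H (-s)) :=
      (k1.1.symm.mul_left k3).mul_left k1.2.symm
    calc expI H s * a * C * b * expI H (-s) = expI H s * ((a * C * b) * expI H (-s)) := by
          noncomm_ring
      _ = (expI H s * expI H (-s)) * (a * C * b) := by rw [k4.eq]; noncomm_ring
      _ = C * (a * b) := by rw [hexp2, one_mul, ← k2.eq, mul_assoc]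
  refine tendsto_const_nhds.congr' ?_
  filter_upwards [eventually_gt_atTop 0] with t ht
  simp_rw [hconst]
  rw [intervalIntegral.integral_const, sub_zero, smul_smul, one_div, inv_mul_cancel₀ ht.ne', one_smul]

end RealCalculus

/-! ## Spectral measures of normal operators -/

section SpectralMeasures

variable {E : Type*} [NormedAddCommGroup E] [InnerProductSpace ℂ E] [CompleteSpace E]

/-- `μ` is the spectral measure of the bounded normal operator `U` at the vector `φ`. -/
def IsNormalSpectralMeasure (U : E →L[ℂ] E) (φ : E) (μ : Measure ℂ) : Prop :=
  IsFiniteMeasure μ ∧ ∀ f : ℂ → ℂ, Continuous f →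
    Integrable f μ ∧ ∫ z, f z ∂μ = ⟪φ, cfc f U φ⟫_ℂ

theorem inner_self_of_isSelfAdjoint {T : E →L[ℂ] E} (hT : IsSelfAdjoint T) (φ : E) :
    ⟪φ, T φ⟫_ℂ = ((⟪φ, T φ⟫_ℂ).re : ℂ) := by
  refine (Complex.conj_eq_iff_re.1 ?_).symm
  rw [inner_conj_symm]
  nth_rw 1 [← hT.star_eq]
  rw [ContinuousLinearMap.star_eq_adjoint, ContinuousLinearMap.adjoint_inner_left]

/-- Riesz–Markov on the compact spectrum, applied to `f ↦ ⟨φ, f(U)φ⟩`. Positivity comes from writing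
`f ≥ 0` as the square of `√f`, whose operator is self-adjoint. -/
theorem exists_isNormalSpectralMeasure {U : E →L[ℂ] E} (hU : IsStarNormal U) (φ : E) :
    ∃ μ : Measure ℂ, IsNormalSpectralMeasure U φ μ := by
  let hom := cfcHom (R := ℂ) (a := U) hU
  have : CompactSpace (spectrum ℂ U) := isCompact_iff_compactSpace.1 (spectrum.isCompact U)
  let e : CompactlySupportedContinuousMap (spectrum ℂ U) ℝ → C(spectrum ℂ U, ℂ) := fun f =>
    ⟨fun z => (f z : ℂ), Complex.continuous_ofReal.comp f.continuous⟩
  have hsa : ∀ f, IsSelfAdjoint (hom (e f)) := by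
    intro f
    rw [IsSelfAdjoint, ← map_star]
    congr 1
    ext z
    exact Complex.conj_ofReal _
  let Λ : CompactlySupportedContinuousMap (spectrum ℂ U) ℝ →ₚ[ℝ] ℝ := PositiveLinearMap.mk₀
    { toFun := fun f => (⟪φ, hom (e f) φ⟫_ℂ).re
      map_add' := fun f g => by
        have : e (f + g) = e f + e g := by
          ext z
          exact Complex.ofReal_add _ _
        rw [this, map_add, add_apply, inner_add_right, Complex.add_re]
      map_smul' := fun c f => by
        have : e (c • f) = (c : ℂ) • e f := by
          ext z
          exact Complex.ofReal_mul _ _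
        rw [this, map_smul, smul_apply, inner_smul_right, Complex.re_ofReal_mul]
        rfl } (by
      intro f hf
      let g : CompactlySupportedContinuousMap (spectrum ℂ U) ℝ :=
        ⟨⟨fun z => √(f z), f.continuous.sqrt⟩, HasCompactSupport.of_compactSpace _⟩
      have hg : e f = e g * e g := by
        ext z
        change (f z : ℂ) = (√(f z) : ℂ) * (√(f z) : ℂ)
        rw [← Complex.ofReal_mul, Real.mul_self_sqrt (hf z)]
      change 0 ≤ (⟪φ, hom (e f) φ⟫_ℂ).re
      rw [hg, map_mul, mul_apply_eq_comp]
      nth_rw 1 [← (hsa g).star_eq]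
      rw [ContinuousLinearMap.star_eq_adjoint, ContinuousLinearMap.adjoint_inner_right]
      exact inner_self_nonneg (𝕜 := ℂ))
  set ν := RealRMK.rieszMeasure Λ with hν
  have hΛ : ∀ f, ((∫ z, f z ∂ν : ℝ) : ℂ) = ⟪φ, hom (e f) φ⟫_ℂ := by
    intro f
    rw [RealRMK.integral_rieszMeasure, inner_self_of_isSelfAdjoint (hsa f)]
    rfl
  have hint : ∀ g : C(spectrum ℂ U, ℂ), Integrable g ν := fun g => by
    refine Integrable.of_bound (C := ‖g‖) g.continuous.aestronglyMeasurable
      (Eventually.of_forall fun z => g.norm_coe_le_norm z)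
  have key : ∀ g : C(spectrum ℂ U, ℂ), ∫ z, g z ∂ν = ⟪φ, hom g φ⟫_ℂ := by
    intro g
    let a : CompactlySupportedContinuousMap (spectrum ℂ U) ℝ :=
      ⟨⟨fun z => (g z).re, Complex.continuous_re.comp g.continuous⟩,
        HasCompactSupport.of_compactSpace _⟩
    let b : CompactlySupportedContinuousMap (spectrum ℂ U) ℝ :=
      ⟨⟨fun z => (g z).im, Complex.continuous_im.comp g.continuous⟩,
        HasCompactSupport.of_compactSpace _⟩
    have hg : g = e a + Complex.I • e b := by
      ext z
      change g z = ((g z).re : ℂ) + Complex.I * ((g z).im : ℂ)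
      rw [mul_comm, Complex.re_add_im]
    have h1 := integral_re_add_im (𝕜 := ℂ) (hint g)
    have h2 : ((∫ z, (g z).re ∂ν : ℝ) : ℂ) = ⟪φ, hom (e a) φ⟫_ℂ := hΛ a
    have h3 : ((∫ z, (g z).im ∂ν : ℝ) : ℂ) = ⟪φ, hom (e b) φ⟫_ℂ := hΛ b
    have h4 : ∫ z, g z ∂ν = ⟪φ, hom (e a) φ⟫_ℂ + ⟪φ, hom (e b) φ⟫_ℂ * Complex.I := by
      rw [← h1, ← h2, ← h3]
      rfl
    rw [h4]
    conv_rhs => rw [hg]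
    rw [map_add, map_smul, add_apply, smul_apply, inner_add_right, inner_smul_right, mul_comm _ Complex.I]
  refine ⟨ν.map Subtype.val, inferInstance, fun f hf => ?_⟩
  have hm : AEMeasurable (Subtype.val : spectrum ℂ U → ℂ) ν := measurable_subtype_coe.aemeasurable
  let g : C(spectrum ℂ U, ℂ) := ⟨_, hf.continuousOn.domRestrict⟩
  constructor
  · exact (integrable_map_measure hf.aestronglyMeasurable hm).2 (hint g)
  · rw [integral_map hm hf.aestronglyMeasurable, cfc_apply f U hU hf.continuousOn]
    exact key g

namespace IsNormalSpectralMeasure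

variable {U : E →L[ℂ] E} {φ ψ : E} {μ ν α β : Measure ℂ}

theorem integral_ofReal (h : IsNormalSpectralMeasure U φ μ) {f : ℂ → ℝ} (hf : Continuous f) :
    ((∫ z, f z ∂μ : ℝ) : ℂ) = ⟪φ, cfc (fun z => (f z : ℂ)) U φ⟫_ℂ := by
  have h1 := (h.2 (fun z => (f z : ℂ)) (Complex.continuous_ofReal.comp hf)).2
  rw [← h1]
  exact _root_.integral_ofReal.symm

theorem integrable_real (h : IsNormalSpectralMeasure U φ μ) {f : ℂ → ℝ} (hf : Continuous f) :
    Integrable f μ :=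
  (h.2 _ (Complex.continuous_ofReal.comp hf)).1.re

theorem real_univ (hU : IsStarNormal U) (h : IsNormalSpectralMeasure U φ μ) :
    μ.real Set.univ = ‖φ‖ ^ 2 := by
  have h1 := h.integral_ofReal (f := fun _ => 1) continuous_const
  simp only [integral_const, smul_eq_mul, mul_one, Complex.ofReal_one] at h1
  have h2 : (1 : E →L[ℂ] E) φ = φ := rfl
  rw [cfc_const_one ℂ U, h2, inner_self_eq_norm_sq_to_K] at h1
  exact Complex.ofReal_injective (h1.trans (by push_cast; rfl))

theorem parallelogram (hφ : IsNormalSpectralMeasure U φ μ) (hψ : IsNormalSpectralMeasure U ψ ν)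
    (hα : IsNormalSpectralMeasure U (φ + ψ) α) (hβ : IsNormalSpectralMeasure U (φ - ψ) β) :
    α + β = (μ + μ) + (ν + ν) := by
  have := hφ.1
  have := hψ.1
  have := hα.1
  have := hβ.1
  refine ext_of_forall_integral_eq_of_IsFiniteMeasure fun f => ?_
  have iφ := hφ.integrable_real f.continuous
  have iψ := hψ.integrable_real f.continuous
  have iα := hα.integrable_real f.continuous
  have iβ := hβ.integrable_real f.continuous
  rw [integral_add_measure iα iβ, integral_add_measure (iφ.add_measure iφ) (iψ.add_measure iψ),
    integral_add_measure iφ iφ, integral_add_measure iψ iψ]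
  have h : (((∫ z, f z ∂α) + ∫ z, f z ∂β : ℝ) : ℂ) =
      (((∫ z, f z ∂μ) + ∫ z, f z ∂μ) + ((∫ z, f z ∂ν) + ∫ z, f z ∂ν) : ℝ) := by
    push_cast
    rw [hφ.integral_ofReal f.continuous, hψ.integral_ofReal f.continuous,
      hα.integral_ofReal f.continuous, hβ.integral_ofReal f.continuous]
    simp only [map_add, map_sub, inner_add_left, inner_add_right, inner_sub_left, inner_sub_right]
    ring
  exact_mod_cast h

/-- The vectors whose spectral measure ignores `S` form a closed set: the parallelogram law for `ψ`
and `φ - ψ` gives `μ(S) ≤ 2ν(S) + 2‖φ - ψ‖²`. -/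
theorem null_of_approx (hU : IsStarNormal U) (hμ : IsNormalSpectralMeasure U φ μ) {S : Set ℂ}
    (h : ∀ ε : ℝ, 0 < ε → ∃ ψ : E, ‖φ - ψ‖ < ε ∧
      ∃ ν : Measure ℂ, IsNormalSpectralMeasure U ψ ν ∧ ν S = 0) : μ S = 0 := by
  have := hμ.1
  rw [← measureReal_eq_zero_iff]
  refine le_antisymm (le_of_forall_pos_le_add fun ε hε => ?_) measureReal_nonneg
  obtain ⟨ψ, hψ, ν, hν, hνS⟩ := h (√(ε / 2)) (by positivity)
  obtain ⟨α, hα⟩ := exists_isNormalSpectralMeasure hU (φ - ψ)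
  obtain ⟨β, hβ⟩ := exists_isNormalSpectralMeasure hU (ψ - (φ - ψ))
  have := hν.1
  have := hα.1
  have := hβ.1
  have hμ' : IsNormalSpectralMeasure U (ψ + (φ - ψ)) μ := by rwa [add_sub_cancel]
  have hp : (μ + β).real S = ((ν + ν) + (α + α)).real S := by rw [parallelogram hν hα hμ' hβ]
  rw [measureReal_add_apply, measureReal_add_apply, measureReal_add_apply,
    measureReal_add_apply] at hp
  have h1 : ν.real S = 0 := by rw [measureReal_eq_zero_iff]; exact hνS
  have h2 : α.real S ≤ ‖φ - ψ‖ ^ 2 := (measureReal_mono (Set.subset_univ S)).trans_eq (hα.real_univ hU)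
  have h3 : ‖φ - ψ‖ ^ 2 ≤ ε / 2 := by
    calc ‖φ - ψ‖ ^ 2 ≤ √(ε / 2) ^ 2 := by gcongr
      _ = ε / 2 := Real.sq_sqrt (by positivity)
  have h4 : 0 ≤ β.real S := measureReal_nonneg
  linarith

/-- The spectral measure at `g(U)ψ` is morally `|g|² ν`. The test function `1/(1 + (n + 1)|g|²)`
equals 1 on the zero set, and its `μ`-integral is a `ν`-integral of a function at most `1/(n + 1)`.
-/
theorem null_of_cfc_apply (hU : IsStarNormal U) {g : ℂ → ℂ} (hg : Continuous g)
    (hμ : IsNormalSpectralMeasure U (cfc g U ψ) μ) : μ {z | g z = 0} = 0 := by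
  have := hμ.1
  obtain ⟨ν, hν⟩ := exists_isNormalSpectralMeasure hU ψ
  have := hν.1
  rw [← measureReal_eq_zero_iff]
  have hbound : ∀ n : ℕ, μ.real {z | g z = 0} ≤ 1 / ((n : ℝ) + 1) * ν.real Set.univ := by
    intro n
    have hden : ∀ z, 0 < 1 + ((n : ℝ) + 1) * ‖g z‖ ^ 2 := fun z => by positivity
    have hf : Continuous fun z => (1 + ((n : ℝ) + 1) * ‖g z‖ ^ 2)⁻¹ :=
      Continuous.inv₀ (by fun_prop) fun z => (hden z).ne'
    have hf2 : Continuous fun z => ‖g z‖ ^ 2 * (1 + ((n : ℝ) + 1) * ‖g z‖ ^ 2)⁻¹ :=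
      (hg.norm.pow 2).mul hf
    have h1 : μ.real {z | g z = 0} ≤ ∫ z, (1 + ((n : ℝ) + 1) * ‖g z‖ ^ 2)⁻¹ ∂μ := by
      have := mul_meas_ge_le_integral_of_nonneg (μ := μ)
        (Eventually.of_forall fun z => (inv_pos.2 (hden z)).le) (hμ.integrable_real hf) 1
      rw [one_mul] at this
      refine (measureReal_mono fun z hz => ?_).trans this
      have hz' : g z = 0 := hz
      simp [hz']
    have h2 : ∫ z, (1 + ((n : ℝ) + 1) * ‖g z‖ ^ 2)⁻¹ ∂μ =
        ∫ z, ‖g z‖ ^ 2 * (1 + ((n : ℝ) + 1) * ‖g z‖ ^ 2)⁻¹ ∂ν := by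
      have h3 := hμ.integral_ofReal hf
      have h4 := hν.integral_ofReal hf2
      have hfc : Continuous fun z => (((1 + ((n : ℝ) + 1) * ‖g z‖ ^ 2)⁻¹ : ℝ) : ℂ) :=
        Complex.continuous_ofReal.comp hf
      have hgc : Continuous fun z => star (g z) := hg.star
      have hfg : Continuous fun z => (((1 + ((n : ℝ) + 1) * ‖g z‖ ^ 2)⁻¹ : ℝ) : ℂ) * g z :=
        hfc.mul hg
      rw [← ContinuousLinearMap.adjoint_inner_right, ← ContinuousLinearMap.star_eq_adjoint,
        ← cfc_star, ← mul_apply_eq_comp, ← mul_apply_eq_comp, mul_assoc,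
        ← cfc_mul _ g U hfc.continuousOn hg.continuousOn,
        ← cfc_mul _ _ U hgc.continuousOn hfg.continuousOn] at h3
      have h5 : (fun z => star (g z) * ((((1 + ((n : ℝ) + 1) * ‖g z‖ ^ 2)⁻¹ : ℝ) : ℂ) * g z)) =
          fun z => ((‖g z‖ ^ 2 * (1 + ((n : ℝ) + 1) * ‖g z‖ ^ 2)⁻¹ : ℝ) : ℂ) := by
        funext z
        have h6 : star (g z) * g z = ((‖g z‖ ^ 2 : ℝ) : ℂ) := by
          push_cast
          exact RCLike.conj_mul (g z)
        rw [Complex.ofReal_mul, ← h6]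
        ring
      rw [h5, ← h4] at h3
      exact_mod_cast h3
    rw [h2] at h1
    refine h1.trans ?_
    calc ∫ z, ‖g z‖ ^ 2 * (1 + ((n : ℝ) + 1) * ‖g z‖ ^ 2)⁻¹ ∂ν
        ≤ ∫ _, 1 / ((n : ℝ) + 1) ∂ν := by
          refine integral_mono (hν.integrable_real hf2) (integrable_const _) fun z => ?_
          change ‖g z‖ ^ 2 * (1 + ((n : ℝ) + 1) * ‖g z‖ ^ 2)⁻¹ ≤ 1 / ((n : ℝ) + 1)
          rw [← div_eq_mul_inv, div_le_div_iff₀ (hden z) (by positivity)]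
          linarith
      _ = 1 / ((n : ℝ) + 1) * ν.real Set.univ := by
          rw [integral_const, smul_eq_mul, mul_comm]
  have hlim := tendsto_one_div_add_atTop_nhds_zero_nat (𝕜 := ℝ) |>.mul_const (ν.real Set.univ)
  rw [zero_mul] at hlim
  exact le_antisymm (ge_of_tendsto' hlim hbound) measureReal_nonneg

/-- Conjugation by a unitary commutes with the functional calculus, so `⟨Vφ, f(U)Vφ⟩ = ⟨φ, f(cU)φ⟩`.
-/
theorem map_rotation (hU : IsStarNormal U) (hμ : IsNormalSpectralMeasure U φ μ) {V : E →L[ℂ] E}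
    (hV : V ∈ unitary (E →L[ℂ] E)) {c : ℂ} (hVU : star V * U * V = c • U) :
    IsNormalSpectralMeasure U (V φ) (μ.map fun z => c * z) := by
  have := hμ.1
  have hm : Measurable fun z : ℂ => c * z := measurable_const_mul c
  refine ⟨inferInstance, fun f hf => ?_⟩
  have hfc : Continuous fun z => f (c * z) := by fun_prop
  refine ⟨(integrable_map_measure hf.aestronglyMeasurable hm.aemeasurable).2 (hμ.2 _ hfc).1, ?_⟩
  rw [integral_map hm.aemeasurable hf.aestronglyMeasurable, (hμ.2 _ hfc).2]
  have h1 : cfc (fun z => f (c * z)) U = cfc f (c • U) := by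
    rw [← cfc_comp_smul c f U]
    rfl
  let u : unitary (E →L[ℂ] E) := ⟨star V, Unitary.star_mem hV⟩
  have h2 : Unitary.conjStarAlgAut ℂ _ u (cfc f U) =
      cfc f (Unitary.conjStarAlgAut ℂ _ u U) := by
    refine StarAlgHomClass.map_cfc (S := ℂ) _ f U hf.continuousOn ?_ hU ?_
    · have : (⇑(Unitary.conjStarAlgAut ℂ (E →L[ℂ] E) u)) = fun x => star V * x * V := by
        funext x
        rw [Unitary.conjStarAlgAut_apply]
        simp [u]
      rw [this]
      fun_prop
    · rw [Unitary.conjStarAlgAut_apply]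
      change IsStarNormal (star V * U * star (star V))
      rw [star_star, hVU]
      infer_instance
  rw [Unitary.conjStarAlgAut_apply, Unitary.conjStarAlgAut_apply] at h2
  change star V * _ * star (star V) = cfc f (star V * _ * star (star V)) at h2
  rw [star_star, hVU, ← h1] at h2
  rw [← h2, ContinuousLinearMap.star_eq_adjoint, mul_apply_eq_comp, mul_apply_eq_comp,
    ContinuousLinearMap.adjoint_inner_right]

end IsNormalSpectralMeasure

/-- The preimage of a null set is null away from the critical points. -/
theorem volume_preimage_regular_eq_zero {h h' : ℝ → ℝ} (hd : ∀ x, HasStrictDerivAt h (h' x) x)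
    (hh' : Continuous h') {B : Set ℝ} (hB : MeasurableSet B) (hB0 : volume B = 0) :
    volume {x | h x ∈ B ∧ h' x ≠ 0} = 0 := by
  refine measure_null_of_locally_null _ fun x hx => ?_
  have hc : Continuous h := continuous_iff_continuousAt.2 fun x => (hd x).hasDerivAt.continuousAt
  -- Near a regular point `h` is injective by the inverse function theorem; change of variables then
  -- makes the integral of `|h'|` over the preimage equal to the volume of a subset of `B`.
  let R := ((hd x).hasStrictFDerivAt_equiv hx.2).toOpenPartialHomeomorph h
  have hxR : x ∈ R.source := HasStrictFDerivAt.mem_toOpenPartialHomeomorph_source _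
  have hinj : Set.InjOn h R.source := R.injOn
  have hms : MeasurableSet (R.source ∩ {x | h x ∈ B}) :=
    R.open_source.measurableSet.inter (hc.measurable hB)
  refine ⟨(R.source ∩ {x | h x ∈ B}) ∩ {x | h' x ≠ 0}, ?_, ?_⟩
  · filter_upwards [mem_nhdsWithin_of_mem_nhds (R.open_source.mem_nhds hxR), self_mem_nhdsWithin]
      with y hy1 hy2 using ⟨⟨hy1, hy2.1⟩, hy2.2⟩
  · have h1 := lintegral_image_eq_lintegral_abs_deriv_mul hms
      (fun y _ => (hd y).hasDerivAt.hasDerivWithinAt) (hinj.mono Set.inter_subset_left) fun _ => 1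
    have h2 : volume (h '' (R.source ∩ {x | h x ∈ B})) = 0 :=
      measure_mono_null (by rintro _ ⟨y, hy, rfl⟩; exact hy.2) hB0
    rw [setLIntegral_measure_zero _ _ h2] at h1
    have hmeas : Measurable fun y => ENNReal.ofReal |h' y| * 1 := by fun_prop
    have h3 := (lintegral_eq_zero_iff hmeas).1 h1.symm
    have h4 := (ae_restrict_iff' hms).1 h3
    refine measure_mono_null ?_ h4
    rintro y ⟨hy1, hy2⟩ hy3
    have := hy3 hy1
    simp at this
    exact hy2 this

/-- Absolute continuity of the real part of a normal operator with rotation symmetry, away from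
the real axis. -/
theorem IsNormalSpectralMeasure.null_re_preimage {U : E →L[ℂ] E} (hU : IsStarNormal U)
    {V : ℝ → E →L[ℂ] E} (hV : ∀ θ, V θ ∈ unitary (E →L[ℂ] E)) (hV0 : V 0 = 1)
    (hVc : ∀ φ, Continuous fun θ => V θ φ)
    (hVU : ∀ θ : ℝ, star (V θ) * U * V θ = Complex.exp (θ * Complex.I) • U)
    {φ : E} {μ : Measure ℂ} (hμ : IsNormalSpectralMeasure U φ μ) {B : Set ℝ}
    (hB : MeasurableSet B) (hB0 : volume B = 0) :
    μ {z | 2 * z.re ∈ B ∧ z.im ≠ 0} = 0 := by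
  have := hμ.1
  have hS : MeasurableSet {z : ℂ | 2 * z.re ∈ B ∧ z.im ≠ 0} := by
    refine MeasurableSet.inter ?_ ?_
    · exact (Complex.measurable_re.const_mul 2) hB
    · exact (Complex.measurable_im (measurableSet_singleton 0)).compl
  have hslice : ∀ z : ℂ, ∀ᵐ θ : ℝ,
      ¬ (Complex.exp (θ * Complex.I) * z) ∈ {z : ℂ | 2 * z.re ∈ B ∧ z.im ≠ 0} := by
    intro z
    have hd : ∀ θ : ℝ, HasStrictDerivAt
        (fun θ : ℝ => 2 * (Real.cos θ * z.re - Real.sin θ * z.im))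
        (2 * (-Real.sin θ * z.re - Real.cos θ * z.im)) θ := fun θ =>
      (((Real.hasStrictDerivAt_cos θ).mul_const _).sub
        ((Real.hasStrictDerivAt_sin θ).mul_const _)).const_mul 2
    have := volume_preimage_regular_eq_zero hd (by fun_prop) hB hB0
    refine measure_mono_null ?_ this
    intro θ hθ
    simp only [Set.mem_compl_iff, Set.mem_ofPred_eq, not_not, Complex.mul_re, Complex.mul_im,
      Complex.exp_ofReal_mul_I_re, Complex.exp_ofReal_mul_I_im] at hθ ⊢
    -- The `θ`-derivative of `2 Re (e^{iθ} z)` is `-2 Im (e^{iθ} z)`, so non-real points are regular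
    -- points.
    refine ⟨hθ.1, fun h0 => hθ.2 ?_⟩
    linarith
  have hmeas : MeasurableSet {p : ℂ × ℝ |
      ¬ (Complex.exp (p.2 * Complex.I) * p.1) ∈ {z : ℂ | 2 * z.re ∈ B ∧ z.im ≠ 0}} := by
    have : Measurable fun p : ℂ × ℝ => Complex.exp (p.2 * Complex.I) * p.1 :=
      Continuous.measurable (by fun_prop)
    exact (this hS).compl
  have hae := (Measure.ae_ae_comm (μ := μ) (ν := volume) hmeas).1 (Eventually.of_forall hslice)
  refine hμ.null_of_approx hU fun ε hε => ?_
  have hnear : {θ : ℝ | ‖φ - V θ φ‖ < ε} ∈ 𝓝 (0 : ℝ) := by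
    have hc : Continuous fun θ => ‖φ - V θ φ‖ := (continuous_const.sub (hVc φ)).norm
    refine hc.continuousAt.eventually_lt continuousAt_const ?_
    simpa [hV0] using hε
  -- A set of full Lebesgue measure is dense, so good angles exist arbitrarily close to 0.
  obtain ⟨θ, hθ1, hθ2⟩ := (Measure.dense_of_ae hae).inter_nhds_nonempty hnear
  refine ⟨V θ φ, hθ2, _, hμ.map_rotation hU (hV θ) (hVU θ), ?_⟩
  rw [Measure.map_apply (measurable_const_mul _) hS]
  have := ae_iff.1 hθ1
  simpa using this

end SpectralMeasures

/-! ### Commutators with the shift, and gauge rotations -/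

section GraphCommutators

variable {X : Type*} {r : X → X → Prop}

theorem relOp_of_formalA (h : BoundedRel r) {Φ : X → ℤ} (hΦ : IsPositionFunction r Φ)
    {φ η : EllTwo X} (hη : ∀ x, η x = formalA h Φ φ x) (x : X) :
    relOp h η x = Complex.I * ((Φ x + 3 / 2) * relOp h (relOp h φ) x -
      (Φ x + 1 / 2) * relOp h (relOp h.swap φ) x) := by
  rw [relOp_apply_eq_sum, relOp_apply_eq_sum h (relOp h φ), relOp_apply_eq_sum h (relOp h.swap φ),
    Finset.mul_sum, Finset.mul_sum, ← Finset.sum_sub_distrib, Finset.mul_sum]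
  refine Finset.sum_congr rfl fun y hy => ?_
  have : r x y := by simpa using hy
  rw [hη, formalA, hΦ x y this]
  push_cast
  ring

theorem relOp_swap_of_formalA (h : BoundedRel r) {Φ : X → ℤ} (hΦ : IsPositionFunction r Φ)
    {φ η : EllTwo X} (hη : ∀ x, η x = formalA h Φ φ x) (x : X) :
    relOp h.swap η x = Complex.I * ((Φ x - 1 / 2) * relOp h.swap (relOp h φ) x -
      (Φ x - 3 / 2) * relOp h.swap (relOp h.swap φ) x) := by
  rw [relOp_apply_eq_sum, relOp_apply_eq_sum h.swap (relOp h φ),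
    relOp_apply_eq_sum h.swap (relOp h.swap φ),
    Finset.mul_sum, Finset.mul_sum, ← Finset.sum_sub_distrib, Finset.mul_sum]
  refine Finset.sum_congr rfl fun y hy => ?_
  have : r y x := by simpa using hy
  have e : (Φ y : ℂ) = Φ x - 1 := by rw [hΦ y x this]; push_cast; ring
  rw [hη, formalA, e]
  ring

theorem hasCommutator_conjugateA_of_formalA (h : BoundedRel r) {Φ : X → ℤ}
    (hΦ : IsPositionFunction r Φ) {S C : EllTwo X →L[ℂ] EllTwo X}
    (hS : ∀ φ ∈ finSupp X, S φ ∈ finSupp X)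
    (hC : ∀ φ η : EllTwo X, (∀ x, η x = formalA h Φ φ x) → ∀ x,
      formalA h Φ (S φ) x = S η x + C φ x) : HasCommutator (conjugateA h Φ) S C := by
  refine HasCommutator.of_core (graph_conjugateA h Φ) fun p hp => ?_
  obtain ⟨φ, h1, h2⟩ := (LinearPMap.mem_graph_iff _).1 hp
  refine (LinearPMap.mem_graph_iff _).2 ⟨⟨S φ, hS _ φ.2⟩, congrArg S h1, ?_⟩
  ext x
  refine (preConjugateA_eq_formalA h hΦ _ x).trans ?_
  have h3 : ∀ x, p.2 x = formalA h Φ (φ : EllTwo X) x := by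
    intro x
    rw [← h2]
    exact preConjugateA_eq_formalA h hΦ φ x
  rw [← h1]
  exact hC _ _ h3 x

/-- By normality the mixed products `U*U` and `UU*` coincide; the terms containing `Φ` cancel and
only the unit shift of the coefficients survives. -/
theorem hasCommutator_relOp (h : BoundedRel r) {Φ : X → ℤ} (hΦ : IsPositionFunction r Φ)
    (hU : IsStarNormal (relOp h)) : HasCommutator (conjugateA h Φ) (relOp h)
      (-Complex.I • (relOp h * (relOp h - star (relOp h)))) := by
  refine hasCommutator_conjugateA_of_formalA h hΦ (fun φ hφ => relOp_mem_finSupp h hφ)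
    fun φ η hη x => ?_
  have h1 : relOp h.swap (relOp h φ) = relOp h (relOp h.swap φ) := by
    have := hU.star_comm_self.eq
    rw [adjoint_relOp] at this
    exact congrArg (fun T : EllTwo X →L[ℂ] EllTwo X => T φ) this
  have h2 : (-Complex.I • (relOp h * (relOp h - star (relOp h)))) φ x =
      -Complex.I * (relOp h (relOp h φ) x - relOp h (relOp h.swap φ) x) := by
    rw [adjoint_relOp, smul_apply, mul_apply_eq_comp, sub_apply, map_sub]
    rfl
  rw [h2, relOp_of_formalA h hΦ hη, formalA, h1]
  ring

theorem hasCommutator_star_relOp (h : BoundedRel r) {Φ : X → ℤ} (hΦ : IsPositionFunction r Φ)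
    (hU : IsStarNormal (relOp h)) : HasCommutator (conjugateA h Φ) (star (relOp h))
      (Complex.I • (star (relOp h) * (relOp h - star (relOp h)))) := by
  rw [adjoint_relOp]
  refine hasCommutator_conjugateA_of_formalA h hΦ (fun φ hφ => relOp_mem_finSupp h.swap hφ)
    fun φ η hη x => ?_
  have h1 : relOp h.swap (relOp h φ) = relOp h (relOp h.swap φ) := by
    have := hU.star_comm_self.eq
    rw [adjoint_relOp] at this
    exact congrArg (fun T : EllTwo X →L[ℂ] EllTwo X => T φ) this
  have h2 : (Complex.I • (relOp h.swap * (relOp h - relOp h.swap))) φ x =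
      Complex.I * (relOp h.swap (relOp h φ) x - relOp h.swap (relOp h.swap φ) x) := by
    rw [smul_apply, mul_apply_eq_comp, sub_apply, map_sub]
    rfl
  rw [h2, relOp_swap_of_formalA h hΦ hη, formalA, ← h1]
  ring

/-! ### Rotations -/

/-- The unitary operator `e^{iθΦ}`. -/
def gaugeRotation (Φ : X → ℤ) (θ : ℝ) : EllTwo X →L[ℂ] EllTwo X :=
  EllTwo.mulOp (fun x => Complex.exp ((θ * Φ x : ℝ) * Complex.I)) fun _ =>
    (Complex.norm_exp_ofReal_mul_I _).le

theorem gaugeRotation_apply (Φ : X → ℤ) (θ : ℝ) (φ : EllTwo X) (x : X) :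
    gaugeRotation Φ θ φ x = Complex.exp ((θ * Φ x : ℝ) * Complex.I) * φ x := rfl

theorem gaugeRotation_zero (Φ : X → ℤ) : gaugeRotation Φ 0 = 1 := by
  ext φ x
  rw [gaugeRotation_apply]
  simp

theorem gaugeRotation_neg_mul (Φ : X → ℤ) (θ : ℝ) : gaugeRotation Φ (-θ) * gaugeRotation Φ θ = 1 := by
  ext φ x
  rw [mul_apply_eq_comp, gaugeRotation_apply, gaugeRotation_apply, ← mul_assoc, ← Complex.exp_add, ← add_mul,
    ← Complex.ofReal_add]
  simp

theorem star_gaugeRotation (Φ : X → ℤ) (θ : ℝ) : star (gaugeRotation Φ θ) = gaugeRotation Φ (-θ) := by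
  symm
  rw [ContinuousLinearMap.star_eq_adjoint, ContinuousLinearMap.eq_adjoint_iff]
  intro a b
  rw [lp.inner_eq_tsum, lp.inner_eq_tsum]
  refine tsum_congr fun x => ?_
  rw [gaugeRotation_apply, gaugeRotation_apply]
  have : (starRingEnd ℂ) (Complex.exp ((-θ * Φ x : ℝ) * Complex.I)) =
      Complex.exp ((θ * Φ x : ℝ) * Complex.I) := by
    rw [← Complex.exp_conj, map_mul, Complex.conj_ofReal, Complex.conj_I]
    congr 1
    push_cast
    ring
  simp only [RCLike.inner_apply, map_mul, this]
  ring

theorem gaugeRotation_mem_unitary (Φ : X → ℤ) (θ : ℝ) :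
    gaugeRotation Φ θ ∈ unitary (EllTwo X →L[ℂ] EllTwo X) := by
  rw [Unitary.mem_iff, star_gaugeRotation]
  refine ⟨gaugeRotation_neg_mul Φ θ, ?_⟩
  have := gaugeRotation_neg_mul Φ (-θ)
  rwa [neg_neg] at this

theorem continuous_gaugeRotation (Φ : X → ℤ) (φ : EllTwo X) : Continuous fun θ => gaugeRotation Φ θ φ := by
  rw [continuous_iff_continuousAt]
  intro θ₀
  refine EllTwo.tendsto_of_dominated ((2 : ℂ) • φ) (fun x => ?_) (fun θ x => ?_)
  · have : Continuous fun θ : ℝ => Complex.exp ((θ * Φ x : ℝ) * Complex.I) * φ x := by fun_prop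
    exact this.tendsto θ₀
  · rw [gaugeRotation_apply, gaugeRotation_apply]
    refine (norm_sub_le _ _).trans ?_
    rw [norm_mul, norm_mul, Complex.norm_exp_ofReal_mul_I, Complex.norm_exp_ofReal_mul_I,
      lp.coeFn_smul, Pi.smul_apply, norm_smul]
    rw [Complex.norm_ofNat]
    linarith

/-- Each edge raises `Φ` by one, so it contributes the single phase `e^{iθ}`. -/
theorem relOp_mul_gaugeRotation (h : BoundedRel r) {Φ : X → ℤ} (hΦ : IsPositionFunction r Φ) (θ : ℝ) :
    star (gaugeRotation Φ θ) * relOp h * gaugeRotation Φ θ = Complex.exp (θ * Complex.I) • relOp h := by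
  have h1 : relOp h * gaugeRotation Φ θ = Complex.exp (θ * Complex.I) • (gaugeRotation Φ θ * relOp h) := by
    ext φ x
    have e : (Complex.exp (θ * Complex.I) • (gaugeRotation Φ θ * relOp h)) φ x =
      Complex.exp (θ * Complex.I) * (Complex.exp ((θ * Φ x : ℝ) * Complex.I) * relOp h φ x) := rfl
    rw [e, mul_apply_eq_comp, relOp_apply_eq_sum, relOp_apply_eq_sum, Finset.mul_sum, Finset.mul_sum]
    refine Finset.sum_congr rfl fun y hy => ?_
    have : r x y := by simpa using hy
    rw [gaugeRotation_apply, hΦ x y this, ← mul_assoc, ← Complex.exp_add]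
    congr 2
    push_cast
    ring
  rw [mul_assoc, h1, mul_smul_comm, ← mul_assoc, star_gaugeRotation, gaugeRotation_neg_mul, one_mul]

end GraphCommutators

/-! ### Real and imaginary parts of a normal operator -/

section FunctionsOfNormal

variable {E : Type*} [NormedAddCommGroup E] [InnerProductSpace ℂ E] [CompleteSpace E]

theorem realCalculus_add_star {U : E →L[ℂ] E} (hU : IsStarNormal U) {f : ℝ → ℂ}
    (hf : Continuous f) : realCalculus f (U + star U) = cfc (fun z : ℂ => f (2 * z.re)) U := by
  have h1 : U + star U = cfc (fun z : ℂ => z + star z) U := by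
    rw [cfc_add U (fun z : ℂ => z) (fun z : ℂ => star z) (by fun_prop) (by fun_prop),
      cfc_id' ℂ U, cfc_star_id U]
  have hfc : Continuous fun z : ℂ => f z.re := hf.comp Complex.continuous_re
  rw [realCalculus, h1, ← cfc_comp _ _ U hU hfc.continuousOn (by fun_prop)]
  congr 1
  funext z
  change f (z + star z).re = _
  congr 1
  simp
  ring

theorem I_smul_sub_star_eq_cfc {U : E →L[ℂ] E} (hU : IsStarNormal U) :
    Complex.I • (U - star U) = cfc (fun z : ℂ => Complex.I * (z - star z)) U := by
  rw [cfc_const_mul Complex.I (fun z : ℂ => z - star z) U (by fun_prop),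
    cfc_sub (fun z : ℂ => z) (fun z : ℂ => star z) U (by fun_prop) (by fun_prop),
    cfc_id' ℂ U, cfc_star_id U]

/-- If `U` is normal with rotation symmetry, then the real part of `U` is purely absolutely
continuous on the orthogonal complement of the kernel of the imaginary part. -/
theorem isPurelyAbsolutelyContinuous_restrict {U : E →L[ℂ] E} (hU : IsStarNormal U)
    {V : ℝ → E →L[ℂ] E} (hV : ∀ θ, V θ ∈ unitary (E →L[ℂ] E)) (hV0 : V 0 = 1)
    (hVc : ∀ φ, Continuous fun θ => V θ φ)
    (hVU : ∀ θ : ℝ, star (V θ) * U * V θ = Complex.exp (θ * Complex.I) • U)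
    {H K : E →L[ℂ] E} (hH : H = U + star U) (hK : K = Complex.I • (U - star U))
    (hKs : IsSelfAdjoint K)
    (hinv : ∀ φ ∈ (LinearMap.ker K.toLinearMap)ᗮ, H φ ∈ (LinearMap.ker K.toLinearMap)ᗮ) :
    IsPurelyAbsolutelyContinuous (H.restrict hinv) := by
  have hHs : IsSelfAdjoint H := by rw [hH]; exact IsSelfAdjoint.add_star_self U
  have hTs : IsSelfAdjoint (H.restrict hinv) := by
    rw [ContinuousLinearMap.isSelfAdjoint_iff_isSymmetric] at hHs ⊢
    intro x y
    exact hHs x y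
  refine ⟨hTs, fun φ => ?_⟩
  obtain ⟨μ, hμ⟩ := exists_isNormalSpectralMeasure hU (φ : E)
  have hfin := hμ.1
  have hc : Continuous fun z : ℂ => 2 * z.re := by fun_prop
  -- As `H = U + U*`, its spectral measure is the image of that of `U` under `z ↦ 2 Re z`; the
  -- inclusion of the subspace intertwines the calculi of the restriction and of `H`.
  refine ⟨μ.map fun z => 2 * z.re, ⟨inferInstance, fun f hf _ => ?_⟩, ?_⟩
  · rw [integral_map hc.measurable.aemeasurable hf.aestronglyMeasurable,
      (hμ.2 (fun z => f (2 * z.re)) (hf.comp hc)).2]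
    have h1 := realCalculus_intertwine hTs hHs (Submodule.subtypeL _) (fun _ => rfl) hf φ
    have h2 : realCalculus f H = cfc (fun z : ℂ => f (2 * z.re)) U := by
      rw [hH, realCalculus_add_star hU hf]
    rw [h2] at h1
    exact congrArg (fun v => ⟪(φ : E), v⟫_ℂ) h1.symm
  · refine Measure.AbsolutelyContinuous.mk fun B hB hB0 => ?_
    rw [Measure.map_apply hc.measurable hB]
    -- Self-adjointness makes `ker(K)^⊥` the closure of the range of `K`, and `K = g(U)` with `g z =
    -- i(z - z̄)`, which vanishes on the real axis.
    have him : μ {z : ℂ | z.im = 0} = 0 := by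
      refine hμ.null_of_approx hU fun ε hε => ?_
      have hφ := φ.2
      have hcl := ContinuousLinearMap.orthogonal_ker K
      rw [← ContinuousLinearMap.star_eq_adjoint, hKs.star_eq] at hcl
      have hφ' : (φ : E) ∈ closure (Set.range K) := by
        have : (φ : E) ∈ (LinearMap.range K.toLinearMap).topologicalClosure := hcl ▸ hφ
        exact this
      obtain ⟨_, ⟨ψ, rfl⟩, hψ⟩ := Metric.mem_closure_iff.1 hφ' ε hε
      rw [dist_eq_norm] at hψ
      obtain ⟨ν, hν⟩ := exists_isNormalSpectralMeasure hU (K ψ)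
      refine ⟨K ψ, hψ, ν, hν, ?_⟩
      rw [hK, I_smul_sub_star_eq_cfc hU] at hν
      have h0 := hν.null_of_cfc_apply hU (by fun_prop)
      refine measure_mono_null (fun z hz => ?_) h0
      have hz' : star z = z := Complex.conj_eq_iff_im.2 hz
      change Complex.I * (z - star z) = 0
      rw [hz', sub_self, mul_zero]
    refine measure_mono_null (fun z hz => ?_)
      (measure_union_null (hμ.null_re_preimage hU hV hV0 hVc hVU hB hB0) him)
    by_cases h0 : z.im = 0
    · exact Or.inr h0
    · exact Or.inl ⟨hz, h0⟩

theorem commute_realCalculus {T S : E →L[ℂ] E} (hT : IsSelfAdjoint T) (h : Commute S T)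
    (f : ℝ → ℂ) : Commute S (realCalculus f T) :=
  (h.symm.cfc (by rw [hT.star_eq]; exact h.symm) _).symm

theorem HasCommutator.realCalculus_of_contDiff {A : E →ₗ.[ℂ] E} (hA : A.IsClosed)
    {T C : E →L[ℂ] E} (hT : IsSelfAdjoint T) (hTC : Commute T C) (h : HasCommutator A T C)
    {f : ℝ → ℂ} (hf : ContDiff ℝ 1 f) :
    HasCommutator A (_root_.realCalculus f T) (_root_.realCalculus (deriv f) T * C) :=
  h.realCalculus hA hT hTC (fun x => (hf.differentiable one_ne_zero x).hasDerivAt)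
    (hf.continuous_deriv le_rfl)

/-- Near 0 the product is identically zero, so the singularity of `x⁻¹` is harmless. -/
theorem contDiff_inv_mul {η : ℝ → ℂ} (hη : ContDiff ℝ 1 η) (h0 : (0 : ℝ) ∉ tsupport η) :
    ContDiff ℝ 1 fun x : ℝ => (x : ℂ)⁻¹ * η x := by
  rw [contDiff_iff_contDiffAt]
  intro x
  by_cases hx : x = 0
  · have h1 := notMem_tsupport_iff_eventuallyEq.1 h0
    rw [hx]
    refine (contDiffAt_const (c := (0 : ℂ))).congr_of_eventuallyEq ?_
    filter_upwards [h1] with y hy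
    rw [hy]
    simp
  · exact (Complex.ofRealCLM.contDiff.contDiffAt.inv (by simpa using hx)).mul hη.contDiffAt

end FunctionsOfNormal

/-! ### The operator `K² (H² + 1)⁻¹` -/

section SquareQuotient

variable {E : Type*} [NormedAddCommGroup E] [InnerProductSpace ℂ E] [CompleteSpace E]

theorem isSelfAdjoint_sq_mul_inverse {H K : E →L[ℂ] E} (hH : IsSelfAdjoint H)
    (hK : IsSelfAdjoint K) (hKH : Commute K H) :
    IsSelfAdjoint (K ^ 2 * Ring.inverse (H ^ 2 + 1)) := by
  have hc : Commute (K ^ 2) (Ring.inverse (H ^ 2 + 1)) :=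
    commute_ringInverse ((hKH.pow_pow 2 2).add_right (Commute.one_right _))
  rw [IsSelfAdjoint, star_mul, ← Ring.inverse_star, star_pow, star_add, star_pow, star_one,
    hH.star_eq, hK.star_eq, hc.eq]

/-- The second factor is invertible and commutes with `K²`, and `⟨φ, K²φ⟩ = ‖Kφ‖²`. -/
theorem ker_sq_mul_inverse {H K : E →L[ℂ] E} (hH : IsSelfAdjoint H)
    (hK : IsSelfAdjoint K) (hKH : Commute K H) :
    LinearMap.ker (K ^ 2 * Ring.inverse (H ^ 2 + 1)).toLinearMap = LinearMap.ker K.toLinearMap := by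
  have hc : Commute (K ^ 2) (Ring.inverse (H ^ 2 + 1)) :=
    commute_ringInverse ((hKH.pow_pow 2 2).add_right (Commute.one_right _))
  ext φ
  rw [LinearMap.mem_ker, LinearMap.mem_ker, hc.eq]
  change (Ring.inverse (H ^ 2 + 1) : E →L[ℂ] E) ((K ^ 2) φ) = 0 ↔ K φ = 0
  have hsq : (K ^ 2) φ = K (K φ) := by rw [sq]; rfl
  constructor
  · intro h
    have h1 : (K ^ 2) φ = 0 := by
      have h2 : ((H ^ 2 + 1) * Ring.inverse (H ^ 2 + 1) : E →L[ℂ] E) ((K ^ 2) φ) = 0 := by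
        rw [mul_apply_eq_comp, h, map_zero]
      rwa [Ring.mul_inverse_cancel _ (isUnit_sq_add_one hH)] at h2
    have h3 : ⟪K φ, K φ⟫_ℂ = 0 := by
      nth_rw 1 [← hK.star_eq]
      rw [ContinuousLinearMap.star_eq_adjoint, ContinuousLinearMap.adjoint_inner_left, ← hsq, h1,
        inner_zero_right]
    exact inner_self_eq_zero.1 h3
  · intro h
    rw [hsq, h, map_zero, map_zero]

theorem ker_orthogonal_invariant {H K : E →L[ℂ] E} (hH : IsSelfAdjoint H) (hKH : Commute K H) :
    ∀ φ ∈ (LinearMap.ker K.toLinearMap)ᗮ, H φ ∈ (LinearMap.ker K.toLinearMap)ᗮ := by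
  intro φ hφ
  rw [Submodule.mem_orthogonal] at hφ ⊢
  intro k hk
  have h1 : K k = 0 := hk
  have h2 : H k ∈ LinearMap.ker K.toLinearMap := by
    change K (H k) = 0
    rw [← mul_apply_eq_comp, hKH.eq, mul_apply_eq_comp, h1, map_zero]
  have h3 := hφ _ h2
  nth_rw 1 [← hH.star_eq] at h3
  rwa [ContinuousLinearMap.star_eq_adjoint, ContinuousLinearMap.adjoint_inner_left] at h3

/-- If `[A, H] = iK²` and `[A, K] = -iHK`, then smooth functions of `K² (H² + 1)⁻¹` preserve the
domain of `A`. -/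
theorem realCalculus_sq_mul_inverse_mem_domain {A : E →ₗ.[ℂ] E} (hA : A.IsClosed)
    {H K : E →L[ℂ] E} (hH : IsSelfAdjoint H) (hK : IsSelfAdjoint K) (hKH : Commute K H)
    (cH : HasCommutator A H (Complex.I • K ^ 2))
    (cK2 : HasCommutator A (K ^ 2) (-(2 * Complex.I) • (H * K ^ 2)))
    {f : ℝ → ℂ} (hf : ContDiff ℝ 1 f) {φ : E} (hφ : φ ∈ A.domain) :
    realCalculus f (K ^ 2 * Ring.inverse (H ^ 2 + 1)) φ ∈ A.domain := by
  have hg : ContDiff ℝ 1 fun x : ℝ => (((x ^ 2 + 1 : ℝ) : ℂ))⁻¹ := by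
    have hp : ContDiff ℝ 1 fun x : ℝ => x ^ 2 + 1 := by fun_prop
    refine ContDiff.inv (Complex.ofRealCLM.contDiff.comp hp) fun x h => ?_
    have h' : x ^ 2 + 1 = 0 := Complex.ofReal_eq_zero.1 h
    nlinarith [sq_nonneg x]
  have cR := cH.realCalculus_of_contDiff hA hH ((hKH.pow_left 2).symm.smul_right _) hg
  rw [← inverse_sq_add_one_eq hH] at cR
  set R := Ring.inverse (H ^ 2 + 1) with hR
  set g' := realCalculus (deriv fun x : ℝ => (((x ^ 2 + 1 : ℝ) : ℂ))⁻¹) H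
  have kR : ∀ S : E →L[ℂ] E, Commute S H → Commute S R := fun S hS =>
    commute_ringInverse ((hS.pow_right 2).add_right (Commute.one_right _))
  have kg : ∀ S : E →L[ℂ] E, Commute S H → Commute S g' := fun S hS => commute_realCalculus hH hS _
  have kDH : Commute (K ^ 2 * R) H :=
    (hKH.pow_left 2).mul_left (kR H (Commute.refl H)).symm
  have kDK : Commute (K ^ 2 * R) K :=
    ((Commute.refl K).pow_left 2).mul_left (kR K hKH).symm
  -- The commutator of `A` with `K² R` is built from `H`, `K` and functions of `H`, so it commutes
  -- with `K² R`, as the chain rule requires.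
  refine ((cK2.mul cR).realCalculus_of_contDiff hA (isSelfAdjoint_sq_mul_inverse hH hK hKH) ?_
    hf).map_domain hφ
  refine Commute.add_right ?_ ?_
  · exact (kDK.pow_right 2).mul_right ((kg _ kDH).mul_right ((kDK.pow_right 2).smul_right _))
  · exact ((kDH.mul_right (kDK.pow_right 2)).smul_right _).mul_right (kR _ kDH)

end SquareQuotient

end


/-! ### Assembly of the theorem -/

theorem mainTheorem9 {X : Type*} (G : SimpleGraph X) (hG : HasFiniteDegree G)
    (r : X → X → Prop) (hr : IsSubjacent G r) (hadm : IsAdmissible G r)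
    (H K D : EllTwo X →L[ℂ] EllTwo X)
    (hH : H = adjacencyOp G hG)
    (hK : K = conjugateK (hG.boundedRel_subjacent hr))
    (hD : D = K ^ 2 * Ring.inverse (H ^ 2 + 1)) :
    IsSelfAdjoint H ∧ IsSelfAdjoint K ∧ Commute K H ∧ IsUnit (H ^ 2 + 1) ∧
    (∃ Φ : X → ℤ, IsPositionFunction r Φ) ∧
    (∀ Φ : X → ℤ, IsPositionFunction r Φ →
      ∀ A : EllTwo X →ₗ.[ℂ] EllTwo X, A = conjugateA (hG.boundedRel_subjacent hr) Φ →
        (preConjugateA (hG.boundedRel_subjacent hr) Φ).IsClosable ∧ IsSelfAdjoint A ∧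
        MemC1 A H ∧ IsCommutator A H (K ^ 2) ∧ MemC1 A (K ^ 2) ∧
        IsDegree H A D ∧
        ∀ η : ℝ → ℂ, ContDiff ℝ (⊤ : ℕ∞) η → HasCompactSupport η → (0 : ℝ) ∉ tsupport η →
          ∀ φ ∈ A.domain, realCalculus (fun x : ℝ => (x : ℂ)⁻¹ * η x) D φ ∈ A.domain) ∧
    LinearMap.ker D.toLinearMap = LinearMap.ker K.toLinearMap ∧
    ∃ hinv : ∀ φ ∈ (LinearMap.ker K.toLinearMap)ᗮ, H φ ∈ (LinearMap.ker K.toLinearMap)ᗮ,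
      IsPurelyAbsolutelyContinuous (H.restrict hinv) := by
  have hb := hG.boundedRel_subjacent hr
  have hU : IsStarNormal (relOp hb) := hadm.isStarNormal_relOp hb
  obtain ⟨Φ₀, hΦ₀⟩ := hadm.exists_isPositionFunction hr
  have hHU : H = relOp hb + star (relOp hb) := hH.trans (adjacencyOp_eq hG hr)
  have hKU : K = Complex.I • (relOp hb - star (relOp hb)) := hK.trans (conjugateK_eq hb)
  have hHs : IsSelfAdjoint H := hHU ▸ IsSelfAdjoint.add_star_self _
  have hKs : IsSelfAdjoint K := hK ▸ isSelfAdjoint_conjugateK hb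
  have hUs : Commute (relOp hb) (star (relOp hb)) := hU.star_comm_self.symm
  have hKH : Commute K H := by
    rw [hHU, hKU]
    exact (((Commute.refl _).add_right hUs).sub_left
      (hUs.symm.add_right (Commute.refl _))).smul_left _
  refine ⟨hHs, hKs, hKH, isUnit_sq_add_one hHs, ⟨Φ₀, hΦ₀⟩, ?_, ?_, ?_⟩
  · rintro Φ hΦ A rfl
    have hA := isSelfAdjoint_conjugateA hb hΦ
    have cU := hasCommutator_relOp hb hΦ hU
    have cV := hasCommutator_star_relOp hb hΦ hU
    -- The two shift commutators add up to `-i(U - U*)²`, and `(U - U*)² = -K²`.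
    have cH : HasCommutator (conjugateA hb Φ) H (Complex.I • K ^ 2) := by
      rw [hHU]
      refine (cU.add cV).congr ?_
      rw [hKU, smul_pow, Complex.I_sq, neg_one_smul, sq, sub_mul (relOp hb) (star (relOp hb))]
      module
    have cK : HasCommutator (conjugateA hb Φ) K (-Complex.I • (H * K)) := by
      have hKU' : K = Complex.I • (relOp hb + (-1 : ℂ) • star (relOp hb)) := by
        rw [neg_one_smul, ← sub_eq_add_neg, hKU]
      have c0 := (cU.add (cV.smul (-1))).smul Complex.I
      rw [← hKU'] at c0
      refine c0.congr ?_
      rw [hKU, hHU, mul_smul_comm, add_mul]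
      module
    have cK2 : HasCommutator (conjugateA hb Φ) (K ^ 2) (-(2 * Complex.I) • (H * K ^ 2)) := by
      rw [sq]
      refine (cK.mul cK).congr ?_
      rw [mul_smul_comm, ← mul_assoc, hKH.eq, smul_mul_assoc, mul_assoc, ← add_smul]
      congr 1
      ring
    have comm : IsCommutator (conjugateA hb Φ) H (K ^ 2) := by
      have := cH.isCommutator hA
      rwa [smul_smul, neg_mul, Complex.I_mul_I, neg_neg, one_smul] at this
    refine ⟨preConjugateA_isClosable hb Φ, hA, cH.memC1 hA, comm, cK2.memC1 hA, ?_, ?_⟩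
    · rw [hD]
      exact isDegree_of_commute (hKH.pow_left 2) comm
    · intro η hη _ h0 φ hφ
      rw [hD]
      exact realCalculus_sq_mul_inverse_mem_domain hA.isClosed hHs hKs hKH cH cK2
        (contDiff_inv_mul (hη.of_le (by exact_mod_cast le_top)) h0) hφ
  · rw [hD]
    exact ker_sq_mul_inverse hHs hKs hKH
  -- This conclusion does not involve `A`, so any one position function supplies the rotations.
  · exact ⟨ker_orthogonal_invariant hHs hKH, isPurelyAbsolutelyContinuous_restrict hU
      (gaugeRotation_mem_unitary Φ₀) (gaugeRotation_zero Φ₀) (continuous_gaugeRotation Φ₀)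
      (relOp_mul_gaugeRotation hb hΦ₀) hHU hKU hKs _⟩
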